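/- **Setting.** Bits are encoded in the BB84 states $\sigma_{0,+}=|0\rangle\langle 0|$, $\sigma_{1,+}=|1\rangle\langle 1|$, $\sigma_{0,\times}=|+\rangle\langle +|$, $\sigma_{1,\times}=|-\rangle\langle -|$. For states $\rho^x$ and a distribution $P_X$, $P_g(X|\rho)=\sup_M\sum_x P_X(x)\,\mathrm{Tr}(M_x\rho^x)$ (supremum over POVMs) is the optimal guessing probability. For a superoperator (completely positive trace-preserving map) $\mathcal S$ from a qubit to a finite-dimensional system, let $P_g(X|\mathcal S(\sigma_b))$ be the guessing probability of a uniform bit $X$ from $\mathcal S(\sigma_{X,b})$, and let $\Delta(\mathcal S)\ge 0$ be the smallest number with $P_g(X|\mathcal S(\sigma_+))\,P_g(X|\mathcal S(\sigma_\times))\le\Delta(\mathcal S)^2$. For a cq-state $\rho_{XE}=\sum_x P_X(x)|x\rangle\langle x|\otimes\rho_E^x$ the non-uniformity is $d(X|\rho_E)=\frac12\|\mathbb I/|\mathcal X|\otimes\rho_E-\rho_{XE}\|_{\mathrm{tr}}$. All logarithms are to base 2, and $h$ is the binary entropy. **Protocol (honest Alice).** Let $\mathcal F$ be a non-empty two-universal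 class of functions $\{0,1\}^n\to\{0,1\}^\ell$. Alice picks $X\in\{0,1\}^n$ and $\Theta\in\{+,\times\}^n$ uniformly and sends $\sigma_{X_1,\Theta_1}\otimes\dots\otimes\sigma_{X_n,\Theta_n}$. Bob applies a product superoperator $\bigotimes_{i=1}^n\mathcal S_i$. A fixed set $R\subseteq\{1,\dots,n\}$ of $m$ positions is reported as received. Let $\mathcal I_b=\{i\in R:\Theta_i=b\}$. Alice aborts if $|\mathcal I_+|\le\tau$ or $|\mathcal I_\times|\le\tau$, for a real threshold $\tau$ for which not every $\Theta$ leads to abort. Otherwise she picks $F_+,F_\times\in\mathcal F$ uniformly and independently, and sends $\mathcal I_+,\mathcal I_\times,F_+,F_\times$ and the syndromes $syn(X_{|\mathcal I_+})$, $syn(X_{|\mathcal I_\times})$ with respect to binary linear codes of lengths $|\mathcal I_+|$, $|\mathcal I_\times|$. Her outputs are $S_b=F_b(X_{|\mathcal I_b})$, where $X_{|\mathcal I_b}$ is padded with zeros to length $n$. Let $0\le p_{\rm error}<1/2$, and assume that whenever Alice does not abort each of the two syndromes has at most $h(p_{\rm error})\,m/2$ bits. (In particular this covers the case that Alice proceeds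 only if $|\mathcal I_+|=|\mathcal I_\times|=m/2$ and the code of length $m/2$ has at most $h(p_{\rm error})\,m/2$ parity checks.) Let $C'=+$ if $\prod_{i\in R}P_g(X_i|\mathcal S_i(\sigma_+))\ge\prod_{i\in R}P_g(X_i|\mathcal S_i(\sigma_\times))$ and $C'=\times$ otherwise, let $\overline{C'}$ be the other basis, let $\Delta_{\max}=\max_{i\in R}\Delta(\mathcal S_i)$, and let $\rho_B$ be Bob's complete state, consisting of all the classical information sent by Alice and the systems $\bigotimes_{i=1}^n\mathcal S_i(\sigma_{X_i,\Theta_i})$. **Claim.** Conditioned on Alice not aborting, $\delta_{\rm sec}:=d(S_{\overline{C'}}\,|\,S_{C'}C'\rho_B)$ satisfies $$\delta_{\rm sec}\;\le\;2^{\frac{\ell}{2}-1+h(p_{\rm error})\frac m4}\,(\Delta_{\max})^{\frac{\log(4/3)}{2}m}.$$ -/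

import Mathlib

open scoped Kronecker ComplexOrder

noncomputable section

namespace NoisyStorage

/-! ### Finite-dimensional quantum information -/

/-- The trace norm `Tr √(Aᴴ A)`, as the sum of the square roots of the eigenvalues of `Aᴴ A`. -/
def traceNorm {E : Type*} [Fintype E] [DecidableEq E] (A : Matrix E E ℂ) : ℝ :=
  ∑ i, Real.sqrt ((Matrix.isHermitian_conjTranspose_mul_self A).eigenvalues i)

/-- The projector `|x⟩⟨x|` onto a vector of the standard basis. -/
def proj {𝒳 : Type*} [DecidableEq 𝒳] (x : 𝒳) : Matrix 𝒳 𝒳 ℂ := Matrix.single x x 1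

/-- The partial trace over the first tensor factor. -/
def partialTraceLeft {𝒳 E : Type*} [Fintype 𝒳] (ρ : Matrix (𝒳 × E) (𝒳 × E) ℂ) : Matrix E E ℂ :=
  Matrix.of fun a b => ∑ x, ρ (x, a) (x, b)

/-- The non-uniformity `d(X|ρ_E) = ½ ‖𝟙/|𝒳| ⊗ ρ_E - ρ_{XE}‖` of the first register of a
classical-quantum state `ρ_{XE} = ∑ₓ P(x) |x⟩⟨x| ⊗ ρ_Eˣ` given the second one. -/
def nonUniformity {𝒳 E : Type*} [Fintype 𝒳] [DecidableEq 𝒳] [Fintype E] [DecidableEq E]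
    (ρ : Matrix (𝒳 × E) (𝒳 × E) ℂ) : ℝ :=
  1 / 2 * traceNorm
    (((Fintype.card 𝒳 : ℂ)⁻¹ • (1 : Matrix 𝒳 𝒳 ℂ)) ⊗ₖ partialTraceLeft ρ - ρ)

/-- The tensor product `⨂ᵢ Aᵢ` of finitely many matrices. -/
def tensor {n : ℕ} {d : Fin n → ℕ} (A : ∀ i, Matrix (Fin (d i)) (Fin (d i)) ℂ) :
    Matrix (∀ i, Fin (d i)) (∀ i, Fin (d i)) ℂ :=
  Matrix.of fun a b => ∏ i, A i (a i) (b i)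

/-- The map `id_k ⊗ Φ`. -/
def ampliation {a b : Type*} (k : ℕ) (Φ : Matrix a a ℂ →ₗ[ℂ] Matrix b b ℂ)
    (A : Matrix (Fin k × a) (Fin k × a) ℂ) : Matrix (Fin k × b) (Fin k × b) ℂ :=
  Matrix.of fun p q => Φ (Matrix.of fun i j => A (p.1, i) (q.1, j)) p.2 q.2

/-- Superoperators (quantum channels): completely positive trace-preserving linear maps. -/
structure IsSuperoperator {a b : Type*} [Fintype a] [Fintype b]
    (Φ : Matrix a a ℂ →ₗ[ℂ] Matrix b b ℂ) : Prop where
  completelyPositive : ∀ (k : ℕ) (A : Matrix (Fin k × a) (Fin k × a) ℂ),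
    A.PosSemidef → (ampliation k Φ A).PosSemidef
  tracePreserving : ∀ A, (Φ A).trace = A.trace

/-- Measurements with outcomes in `𝒳`, given by their POVM elements. -/
structure IsPOVM {𝒳 E : Type*} [Fintype 𝒳] [Fintype E] [DecidableEq E]
    (M : 𝒳 → Matrix E E ℂ) : Prop where
  posSemidef : ∀ x, (M x).PosSemidef
  sum_eq_one : ∑ x, M x = 1

/-- `P_g(X|ρ_E) = sup_M ∑ₓ P_X(x) Tr(M_x ρ_Eˣ)`: the maximal average probability of guessing `x`
by a measurement of `ρ_Eˣ`. -/
def guessProb {𝒳 E : Type*} [Fintype 𝒳] [Fintype E] [DecidableEq E]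
    (P : 𝒳 → ℝ) (ρ : 𝒳 → Matrix E E ℂ) : ℝ :=
  ⨆ M : {M : 𝒳 → Matrix E E ℂ // IsPOVM M}, ∑ x, P x * ((M.1 x * ρ x).trace).re

/-! ### BB84 encoding and the uncertainty quantity -/

/-- The two bases: computational and Hadamard. -/
inductive Basis where
  | plus
  | times
  deriving DecidableEq

instance : Fintype Basis where
  elems := {.plus, .times}
  complete b := by cases b <;> simp

/-- The basis different from `b`. -/
def Basis.other : Basis → Basis
  | .plus => .times
  | .times => .plus

/-- The encoding `σ_{z,b}` of the bit `z` in the basis `b`: the density matrices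
`|0⟩⟨0|`, `|1⟩⟨1|`, `|+⟩⟨+|`, `|-⟩⟨-|`. -/
def bb84 (z : ZMod 2) : Basis → Matrix (Fin 2) (Fin 2) ℂ
  | .plus => if z = 0 then !![1, 0; 0, 0] else !![0, 0; 0, 1]
  | .times => if z = 0 then !![1 / 2, 1 / 2; 1 / 2, 1 / 2] else !![1 / 2, -1 / 2; -1 / 2, 1 / 2]

/-- `P_g(X|𝒮(σ_b))` for a uniformly distributed bit `X`. -/
def bitGuessProb {k : ℕ} (S : Matrix (Fin 2) (Fin 2) ℂ →ₗ[ℂ] Matrix (Fin k) (Fin k) ℂ)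
    (b : Basis) : ℝ :=
  guessProb (fun _ : ZMod 2 => (1 / 2 : ℝ)) (fun z => S (bb84 z b))

/-- The smallest `Δ(𝒮) ≥ 0` with `P_g(X|𝒮(σ_+)) · P_g(X|𝒮(σ_×)) ≤ Δ(𝒮)²`. -/
def Delta {k : ℕ} (S : Matrix (Fin 2) (Fin 2) ℂ →ₗ[ℂ] Matrix (Fin k) (Fin k) ℂ) : ℝ :=
  Real.sqrt (bitGuessProb S .plus * bitGuessProb S .times)

/-! ### Strings, hash functions, syndromes -/

abbrev BitString (n : ℕ) := Fin n → ZMod 2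

/-- The string `x_{|I}` of the bits of `x` at the positions in `I`, in increasing order. -/
def restrict {n : ℕ} (x : BitString n) (I : Finset (Fin n)) : BitString I.card :=
  fun j => x (I.orderEmbOfFin rfl j)

/-- Padding with zeros to length `n`. -/
def pad {j : ℕ} (n : ℕ) (s : BitString j) : BitString n :=
  fun i => if h : (i : ℕ) < j then s ⟨i, h⟩ else 0

abbrev HashFun (n ℓ : ℕ) := BitString n → BitString ℓ

/-- A two-universal class: for `x ≠ y` and `f` uniform in the class, `f x = f y` has
probability at most `2^{-ℓ}`. -/
def IsTwoUniversal {n ℓ : ℕ} (𝓕 : Finset (HashFun n ℓ)) : Prop :=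
  ∀ x y : BitString n, x ≠ y →
    ((𝓕.filter fun f => f x = f y).card : ℝ) / 𝓕.card ≤ (2 : ℝ) ^ (-(ℓ : ℝ))

/-- The binary Shannon entropy `h(p)`, in bits. -/
def binaryEntropy (p : ℝ) : ℝ := Real.binEntropy p / Real.log 2

/-! ### The noise-protected protocol with an honest Alice

`R` is the set of remaining positions. -/

/-- `𝓘_b`: the remaining positions that were encoded in the basis `b`. -/
def indexSet {n : ℕ} (R : Finset (Fin n)) (Θ : Fin n → Basis) (b : Basis) : Finset (Fin n) :=
  R.filter fun i => Θ i = b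

/-- Alice aborts if `|𝓘_+|` or `|𝓘_×|` does not exceed the threshold `τ`. -/
def Aborts {n : ℕ} (R : Finset (Fin n)) (τ : ℝ) (Θ : Fin n → Basis) : Prop :=
  ∃ b, ((indexSet R Θ b).card : ℝ) ≤ τ

/-- Alice's random choices `(X, Θ, F)`: the bits `X`, the bases `Θ`, the hash functions
`F_+`, `F_×`. -/
abbrev Choices (n ℓ : ℕ) := BitString n × (Fin n → Basis) × (Basis → HashFun n ℓ)

/-- The choices of Alice, with hash functions in the class `𝓕`, for which she does not abort. -/
def accepted {n ℓ : ℕ} (R : Finset (Fin n)) (τ : ℝ) (𝓕 : Finset (HashFun n ℓ)) :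
    Finset (Choices n ℓ) :=
  open Classical in
  Finset.univ ×ˢ (Finset.univ.filter fun Θ => ¬ Aborts R τ Θ) ×ˢ
    Fintype.piFinset fun _ : Basis => 𝓕

/-- Alice's output `S_b = F_b(X_{|𝓘_b})`. -/
def output {n ℓ : ℕ} (R : Finset (Fin n)) (w : Choices n ℓ) (b : Basis) : BitString ℓ :=
  let (X, Θ, F) := w
  F b (pad n (restrict X (indexSet R Θ b)))

/-- The syndrome of a string, for the linear code with parity-check matrix `H`. -/
def syndrome {j k : ℕ} (H : Matrix (Fin k) (Fin j) (ZMod 2)) (x : BitString j) : BitString k :=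
  H.mulVec x

/-- The values of the message for one basis `b`: the set `𝓘_b` together with the syndrome
`syn(X_{|𝓘_b})`, where `r j` is the number of parity checks of the code of length `j`. -/
abbrev Message (n : ℕ) (r : ℕ → ℕ) := (I : Finset (Fin n)) × BitString (r I.card)

/-- The values of Bob's classical registers: a string and a basis (for `S_{C'}` and `C'`), the hash
functions `F_+`, `F_×`, and the messages for the two bases. -/
abbrev ClassicalView (n ℓ : ℕ) (r : ℕ → ℕ) :=
  BitString ℓ × Basis × (Basis → HashFun n ℓ) × (Basis → Message n r)

instance {n ℓ : ℕ} {r : ℕ → ℕ} : DecidableEq (ClassicalView n ℓ r) := Classical.decEq _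

/-- Bob's classical information, where `H j` is the parity-check matrix of the code of length `j`
and `c` is the value of `C'`. -/
def classicalView {n ℓ : ℕ} {r : ℕ → ℕ} (R : Finset (Fin n))
    (H : ∀ j, Matrix (Fin (r j)) (Fin j) (ZMod 2)) (c : Basis) (w : Choices n ℓ) :
    ClassicalView n ℓ r :=
  let (X, Θ, F) := w
  (output R w c, c, F, fun b =>
    ⟨indexSet R Θ b, syndrome (H (indexSet R Θ b).card) (restrict X (indexSet R Θ b))⟩)

/-- Bob's quantum information `⨂ᵢ 𝒮ᵢ(σ_{Xᵢ,Θᵢ})`. -/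
def quantumView {n ℓ : ℕ} {d : Fin n → ℕ}
    (S : ∀ i, Matrix (Fin 2) (Fin 2) ℂ →ₗ[ℂ] Matrix (Fin (d i)) (Fin (d i)) ℂ)
    (w : Choices n ℓ) : Matrix (∀ i, Fin (d i)) (∀ i, Fin (d i)) ℂ :=
  let (X, Θ, _) := w
  tensor fun i => S i (bb84 (X i) (Θ i))

/-- `C'`: equal to `+` if `∏ᵢ P_g(Xᵢ|𝒮ᵢ(σ_+)) ≥ ∏ᵢ P_g(Xᵢ|𝒮ᵢ(σ_×))`, the products being over the
remaining positions, and to `×` otherwise. -/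
def choiceBit {n : ℕ} {d : Fin n → ℕ} (R : Finset (Fin n))
    (S : ∀ i, Matrix (Fin 2) (Fin 2) ℂ →ₗ[ℂ] Matrix (Fin (d i)) (Fin (d i)) ℂ) : Basis :=
  open Classical in
  if ∏ i ∈ R, bitGuessProb (S i) .plus ≥ ∏ i ∈ R, bitGuessProb (S i) .times then .plus else .times

/-- The state of Alice's string `S_{¬c}` and of all that Bob holds (`S_c`, `c`, the classical
messages and the stored systems), conditioned on Alice not aborting. -/
def jointState {n ℓ : ℕ} {r : ℕ → ℕ} {d : Fin n → ℕ} (R : Finset (Fin n)) (τ : ℝ)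
    (𝓕 : Finset (HashFun n ℓ)) (H : ∀ j, Matrix (Fin (r j)) (Fin j) (ZMod 2))
    (S : ∀ i, Matrix (Fin 2) (Fin 2) ℂ →ₗ[ℂ] Matrix (Fin (d i)) (Fin (d i)) ℂ) (c : Basis) :
    Matrix (BitString ℓ × ClassicalView n ℓ r × (∀ i, Fin (d i)))
      (BitString ℓ × ClassicalView n ℓ r × (∀ i, Fin (d i))) ℂ :=
  ((accepted R τ 𝓕).card : ℂ)⁻¹ • ∑ w ∈ accepted R τ 𝓕,
    proj (output R w c.other) ⊗ₖ (proj (classicalView R H c w) ⊗ₖ quantumView S w)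

/-- `δ_sec = d(S_{¬C'} | S_{C'} C' ρ_B)`. -/
def deltaSec {n ℓ : ℕ} {r : ℕ → ℕ} {d : Fin n → ℕ} (R : Finset (Fin n)) (τ : ℝ)
    (𝓕 : Finset (HashFun n ℓ)) (H : ∀ j, Matrix (Fin (r j)) (Fin j) (ZMod 2))
    (S : ∀ i, Matrix (Fin 2) (Fin 2) ℂ →ₗ[ℂ] Matrix (Fin (d i)) (Fin (d i)) ℂ) : ℝ :=
  nonUniformity (jointState R τ 𝓕 H S (choiceBit R S))

/-- `Δ_max`: the maximum of `Δ(𝒮ᵢ)` over the remaining positions. -/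
def deltaMax {n : ℕ} {d : Fin n → ℕ} (R : Finset (Fin n))
    (S : ∀ i, Matrix (Fin 2) (Fin 2) ℂ →ₗ[ℂ] Matrix (Fin (d i)) (Fin (d i)) ℂ) : ℝ :=
  ⨆ i : R, Delta (S i)

end NoisyStorage

end

/-! Write `c` for the value of `C'` and `I` for the remaining positions encoded in the other basis.
Fix the bases, the hash function for `c` and all bits outside `I`. Bob then faces a privacy
amplification problem for the bits in `I`, with the syndrome as extra classical information.

The trace norm is realised by one contraction `V`, as the real part of `Tr(V A)`. Each state of Bob
is factored as `Q B Q` with `Q = σ^{1/4}` and `B = σ^{-1/4} ρ σ^{-1/4}`, where `σ` is the sum of the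
states. Cauchy–Schwarz (`IsContraction.re_trace_mul_le`) leaves the square root of `Tr Q⁴` times the
trace of a square. Two-universality kills the terms of that square with distinct strings, so only `∑
Tr B²` survives. This is at most the success weight of the pretty good measurement
(`exists_prettyGood`). The factorisation is made position by position, so a product of single-bit
guessing probabilities `pᵢ` over `I` appears directly, and multiplicativity of the optimal guessing
probability is never needed. The syndrome only multiplies the number of classical values in `Tr Q⁴`,
hence the factor `2^r` under the root.

Averaging the square roots over the accepted bases costs a concavity step. Conditioning on balanced
`I` does not increase the mean of `∏_{i ∈ I} pᵢ` (`sum_window_mul_le`), because its average over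
sets of one size is convex in the size. The unconditioned mean is `∏ (1 + pᵢ)/2`, and `(1 + p)/2 ≤
p^{log(4/3)}` on `[1/2, 1]`. Finally, the product of the `pᵢ` over all remaining positions is the
smaller of the two basis products, so its square is at most `∏ Δ(𝒮ᵢ)²`. -/

namespace NoisyStorage

open Matrix

/-! ### Functions of Hermitian matrices -/

section Spectral

variable {E : Type*} [Fintype E] [DecidableEq E] {A : Matrix E E ℂ}

/-- The function `f` applied to the eigenvalues of a Hermitian matrix. -/
noncomputable def spectralMap (hA : A.IsHermitian) (f : ℝ → ℝ) : Matrix E E ℂ :=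
  (hA.eigenvectorUnitary : Matrix E E ℂ) * diagonal (fun i => (f (hA.eigenvalues i) : ℂ)) *
    (hA.eigenvectorUnitary : Matrix E E ℂ)ᴴ

theorem conjTranspose_eigenvectorUnitary_mul_self (hA : A.IsHermitian) :
    (hA.eigenvectorUnitary : Matrix E E ℂ)ᴴ * (hA.eigenvectorUnitary : Matrix E E ℂ) = 1 :=
  Unitary.coe_star_mul_self _

theorem eigenvectorUnitary_mul_conjTranspose_self (hA : A.IsHermitian) :
    (hA.eigenvectorUnitary : Matrix E E ℂ) * (hA.eigenvectorUnitary : Matrix E E ℂ)ᴴ = 1 :=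
  Unitary.coe_mul_star_self _

theorem spectralMap_mul (hA : A.IsHermitian) (f g : ℝ → ℝ) :
    spectralMap hA f * spectralMap hA g = spectralMap hA fun x => f x * g x := by
  unfold spectralMap
  set U := (hA.eigenvectorUnitary : Matrix E E ℂ)
  have h : Uᴴ * U = 1 := conjTranspose_eigenvectorUnitary_mul_self hA
  calc _ = U * diagonal (fun i => (f (hA.eigenvalues i) : ℂ)) * (Uᴴ * U) *
        diagonal (fun i => (g (hA.eigenvalues i) : ℂ)) * Uᴴ := by simp only [Matrix.mul_assoc]
    _ = _ := by
        rw [h, Matrix.mul_one, Matrix.mul_assoc U, diagonal_mul_diagonal]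
        simp

theorem spectralMap_isHermitian (hA : A.IsHermitian) (f : ℝ → ℝ) :
    (spectralMap hA f).IsHermitian := by
  unfold spectralMap IsHermitian
  simp only [conjTranspose_mul, conjTranspose_conjTranspose, diagonal_conjTranspose,
    Matrix.mul_assoc]
  congr 3
  ext i
  simp

theorem spectralMap_id (hA : A.IsHermitian) : spectralMap hA (fun x => x) = A := by
  conv_rhs => rw [hA.spectral_theorem, Unitary.conjStarAlgAut_apply]
  rfl

theorem spectralMap_one (hA : A.IsHermitian) : spectralMap hA (fun _ => 1) = 1 := by
  simp [spectralMap, eigenvectorUnitary_mul_conjTranspose_self]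

theorem spectralMap_sub (hA : A.IsHermitian) (f g : ℝ → ℝ) :
    spectralMap hA f - spectralMap hA g = spectralMap hA fun x => f x - g x := by
  unfold spectralMap
  rw [← Matrix.sub_mul, ← Matrix.mul_sub, diagonal_sub]
  simp

theorem trace_spectralMap (hA : A.IsHermitian) (f : ℝ → ℝ) :
    (spectralMap hA f).trace = ∑ i, (f (hA.eigenvalues i) : ℂ) := by
  unfold spectralMap
  rw [trace_mul_comm, ← Matrix.mul_assoc, conjTranspose_eigenvectorUnitary_mul_self,
    Matrix.one_mul, trace_diagonal]

theorem spectralMap_congr (hA : A.IsHermitian) {f g : ℝ → ℝ}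
    (h : ∀ i, f (hA.eigenvalues i) = g (hA.eigenvalues i)) :
    spectralMap hA f = spectralMap hA g := by
  simp [spectralMap, h]

end Spectral

/-! ### Traces and the trace norm -/

section Trace

variable {E : Type*} [Fintype E]

theorem re_trace_conjTranspose_mul_self (A : Matrix E E ℂ) :
    (Aᴴ * A).trace.re = ∑ p : E × E, ‖A p.1 p.2‖ ^ 2 := by
  rw [Fintype.sum_prod_type_right, Matrix.trace, Complex.re_sum]
  refine Finset.sum_congr rfl fun i _ => ?_
  rw [Matrix.diag_apply, Matrix.mul_apply, Complex.re_sum]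
  refine Finset.sum_congr rfl fun j _ => ?_
  rw [conjTranspose_apply, RCLike.star_def, Complex.conj_mul', ← Complex.ofReal_pow,
    Complex.ofReal_re]

theorem re_trace_conjTranspose_mul_le (A B : Matrix E E ℂ) :
    (Aᴴ * B).trace.re ≤ √(Aᴴ * A).trace.re * √(Bᴴ * B).trace.re := by
  rw [re_trace_conjTranspose_mul_self, re_trace_conjTranspose_mul_self]
  refine le_trans ?_ (Real.sum_mul_le_sqrt_mul_sqrt _ _ _)
  rw [Fintype.sum_prod_type_right, Matrix.trace, Complex.re_sum]
  refine Finset.sum_le_sum fun i _ => ?_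
  rw [Matrix.diag_apply, Matrix.mul_apply, Complex.re_sum]
  refine Finset.sum_le_sum fun j _ => ?_
  refine (Complex.re_le_norm _).trans ?_
  simp

theorem re_trace_nonneg {A : Matrix E E ℂ} (hA : A.PosSemidef) : 0 ≤ A.trace.re :=
  (Complex.le_def.1 hA.trace_nonneg).1

open scoped MatrixOrder in
theorem exists_conjTranspose_mul_self [DecidableEq E] {A : Matrix E E ℂ} (hA : A.PosSemidef) :
    ∃ C : Matrix E E ℂ, A = Cᴴ * C := by
  obtain ⟨C, hC⟩ := CStarAlgebra.nonneg_iff_eq_star_mul_self.1 hA.nonneg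
  exact ⟨C, hC⟩

theorem re_trace_mul_nonneg [DecidableEq E] {A B : Matrix E E ℂ} (hA : A.PosSemidef)
    (hB : B.PosSemidef) : 0 ≤ (A * B).trace.re := by
  obtain ⟨C, rfl⟩ := exists_conjTranspose_mul_self hA
  rw [Matrix.mul_assoc, trace_mul_comm]
  exact re_trace_nonneg (hB.mul_mul_conjTranspose_same C)

/-- Matrices of operator norm at most one. -/
structure IsContraction [DecidableEq E] (V : Matrix E E ℂ) : Prop where
  left : (1 - V * Vᴴ).PosSemidef
  right : (1 - Vᴴ * V).PosSemidef

theorem posSemidef_one_sub_of_idempotent [DecidableEq E] {P : Matrix E E ℂ}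
    (hP : P.IsHermitian) (hPP : P * P = P) : (1 - P).PosSemidef := by
  have h : (1 - P) = (1 - P)ᴴ * (1 - P) := by
    rw [conjTranspose_sub, conjTranspose_one, hP.eq, Matrix.sub_mul, Matrix.mul_sub,
      Matrix.mul_sub, hPP]
    simp
  rw [h]
  exact posSemidef_conjTranspose_mul_self _

/-- Polar decomposition: `V = |A|⁻¹ Aᴴ` gives `V A = |A|`, with a pseudo-inverse on the kernel, so
`V` is a partial isometry. -/
theorem exists_isContraction_traceNorm_eq [DecidableEq E] (A : Matrix E E ℂ) :
    ∃ V : Matrix E E ℂ, IsContraction V ∧ traceNorm A = (V * A).trace.re := by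
  set hH := isHermitian_conjTranspose_mul_self A
  -- Since `0⁻¹ = 0`, this is the pseudo-inverse of `|A|`.
  set N := spectralMap hH fun x => (√x)⁻¹ with hN
  have hNH : Nᴴ = N := spectralMap_isHermitian hH _
  have h0 : ∀ i, 0 ≤ hH.eigenvalues i := eigenvalues_conjTranspose_mul_self_nonneg A
  have hAA : Aᴴ * A = spectralMap hH fun x => x := (spectralMap_id hH).symm
  have hP : N * Aᴴ * (N * Aᴴ)ᴴ = spectralMap hH fun x => (√x)⁻¹ * x * (√x)⁻¹ := by
    rw [conjTranspose_mul, conjTranspose_conjTranspose, hNH]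
    calc _ = N * (Aᴴ * A) * N := by simp only [Matrix.mul_assoc]
      _ = N * spectralMap hH (fun x => x) * N := congrArg (fun M => N * M * N) hAA
      _ = _ := by rw [hN, spectralMap_mul, spectralMap_mul]
  have hPN : N * Aᴴ * (N * Aᴴ)ᴴ * N = N := by
    rw [hP, hN, spectralMap_mul]
    refine spectralMap_congr _ fun i => ?_
    rcases (h0 i).eq_or_lt with h | h
    · simp [← h]
    · have h1 := Real.sq_sqrt (h0 i)
      have : 0 < √(hH.eigenvalues i) := Real.sqrt_pos.2 h
      field_simp
      rw [h1]
  have hPV : N * Aᴴ * (N * Aᴴ)ᴴ * (N * Aᴴ) = N * Aᴴ := by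
    rw [← Matrix.mul_assoc, hPN]
  refine ⟨N * Aᴴ, ⟨?_, ?_⟩, ?_⟩
  · refine posSemidef_one_sub_of_idempotent (isHermitian_mul_conjTranspose_self _) ?_
    rw [← Matrix.mul_assoc, hPV]
  · refine posSemidef_one_sub_of_idempotent (isHermitian_conjTranspose_mul_self _) ?_
    rw [Matrix.mul_assoc, ← Matrix.mul_assoc (N * Aᴴ), hPV]
  · have h1 : N * Aᴴ * A = N * spectralMap hH fun x => x :=
      (Matrix.mul_assoc _ _ _).trans (congrArg (N * ·) hAA)
    rw [h1, hN, spectralMap_mul, trace_spectralMap, Complex.re_sum]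
    refine Finset.sum_congr rfl fun i _ => ?_
    rw [Complex.ofReal_re]
    rcases (h0 i).eq_or_lt with h | h
    · simp [← h]
    · rw [eq_inv_mul_iff_mul_eq₀ (Real.sqrt_pos.2 h).ne', Real.mul_self_sqrt (h0 i)]

/-- Cauchy–Schwarz twice: once to split `B` from `Q Vᴴ Q`, and once to bound the square of the
latter by `Vᴴ Q²` against `Q² Vᴴ`. Each of these has squared norm at most `Tr Q⁴`, one by each half
of the contraction property. -/
theorem IsContraction.re_trace_mul_le [DecidableEq E] {V : Matrix E E ℂ} (hV : IsContraction V)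
    {Q B : Matrix E E ℂ} (hQ : Q.IsHermitian) (hB : B.IsHermitian) :
    (V * (Q * B * Q)).trace.re ≤ √(Q * Q * (Q * Q)).trace.re * √(B * B).trace.re := by
  have hR : (Q * Q)ᴴ = Q * Q := by rw [conjTranspose_mul, hQ.eq]
  have h1 : (V * (Q * B * Q)).trace = ((Q * Vᴴ * Q)ᴴ * B).trace := by
    rw [conjTranspose_mul, conjTranspose_mul, conjTranspose_conjTranspose, hQ.eq,
      trace_mul_comm V]
    calc _ = (Q * B * (Q * V)).trace := by rw [Matrix.mul_assoc]
      _ = (Q * (B * (Q * V))).trace := by rw [Matrix.mul_assoc]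
      _ = (B * (Q * V) * Q).trace := trace_mul_comm _ _
      _ = (B * (Q * (V * Q))).trace := by simp only [Matrix.mul_assoc]
      _ = _ := trace_mul_comm _ _
  have h2 : ((Q * Vᴴ * Q)ᴴ * (Q * Vᴴ * Q)).trace
      = ((Vᴴ * (Q * Q))ᴴ * (Q * Q * Vᴴ)).trace := by
    simp only [conjTranspose_mul, conjTranspose_conjTranspose, hQ.eq]
    rw [trace_mul_comm]
    calc _ = (Q * (Vᴴ * Q * (Q * (V * Q)))).trace := by simp only [Matrix.mul_assoc]
      _ = ((Vᴴ * Q * (Q * (V * Q))) * Q).trace := trace_mul_comm _ _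
      _ = (Vᴴ * (Q * Q * V * (Q * Q))).trace := by simp only [Matrix.mul_assoc]
      _ = ((Q * Q * V * (Q * Q)) * Vᴴ).trace := trace_mul_comm _ _
      _ = _ := by simp only [Matrix.mul_assoc]
  have hL : ((Vᴴ * (Q * Q))ᴴ * (Vᴴ * (Q * Q))).trace.re ≤ (Q * Q * (Q * Q)).trace.re := by
    have := re_trace_nonneg (hV.left.conjTranspose_mul_mul_same (Q * Q))
    rw [hR, Matrix.mul_sub, Matrix.sub_mul, trace_sub, Complex.sub_re, Matrix.mul_one] at this
    simp only [conjTranspose_mul, conjTranspose_conjTranspose, hQ.eq, Matrix.mul_assoc] at this ⊢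
    linarith
  have hK : ((Q * Q * Vᴴ)ᴴ * (Q * Q * Vᴴ)).trace.re ≤ (Q * Q * (Q * Q)).trace.re := by
    have := re_trace_nonneg (hV.right.conjTranspose_mul_mul_same (Q * Q))
    rw [hR, Matrix.mul_sub, Matrix.sub_mul, trace_sub, Complex.sub_re, Matrix.mul_one] at this
    have h3 : ((Q * Q * Vᴴ)ᴴ * (Q * Q * Vᴴ)).trace = (Q * Q * (Vᴴ * V) * (Q * Q)).trace := by
      rw [trace_mul_comm, conjTranspose_mul, conjTranspose_conjTranspose, hR]
      simp only [Matrix.mul_assoc]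
    rw [h3]
    linarith
  have h4 : ((Q * Vᴴ * Q)ᴴ * (Q * Vᴴ * Q)).trace.re ≤ (Q * Q * (Q * Q)).trace.re := by
    rw [h2]
    refine (re_trace_conjTranspose_mul_le _ _).trans ?_
    have h0 : 0 ≤ (Q * Q * (Q * Q)).trace.re := by
      have := re_trace_nonneg (posSemidef_conjTranspose_mul_self (Q * Q))
      rwa [hR] at this
    calc _ ≤ √(Q * Q * (Q * Q)).trace.re * √(Q * Q * (Q * Q)).trace.re := by gcongr
      _ = _ := Real.mul_self_sqrt h0
  rw [h1]
  refine (re_trace_conjTranspose_mul_le _ _).trans ?_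
  rw [hB.eq]
  gcongr

end Trace

/-! ### The pretty good measurement -/

section PrettyGood

variable {E : Type*} [Fintype E] [DecidableEq E]

theorem mul_eq_zero_of_conj_eq_zero {A P : Matrix E E ℂ} (hA : A.PosSemidef)
    (h : Pᴴ * A * P = 0) : A * P = 0 := by
  obtain ⟨C, rfl⟩ := exists_conjTranspose_mul_self hA
  have : C * P = 0 := by
    rw [← conjTranspose_mul_self_eq_zero, conjTranspose_mul]
    simpa only [Matrix.mul_assoc] using h
  rw [Matrix.mul_assoc, this, Matrix.mul_zero]

/-- The compressions by `1 - P` are positive with total trace zero, so each vanishes: the support of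
each summand lies in that of the sum. -/
theorem conj_eq_self_of_sum {Z : Type*} [Fintype Z] {ρ : Z → Matrix E E ℂ}
    (hρ : ∀ z, (ρ z).PosSemidef) {P : Matrix E E ℂ} (hP : P.IsHermitian)
    (h : (1 - P) * (∑ z, ρ z) * (1 - P) = 0) (z : Z) : P * ρ z * P = ρ z := by
  have hP' : (1 - P)ᴴ = 1 - P := by rw [conjTranspose_sub, hP.eq, conjTranspose_one]
  have hpos : ∀ z, ((1 - P) * ρ z * (1 - P)).PosSemidef := fun z => by
    have := (hρ z).conjTranspose_mul_mul_same (1 - P)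
    rwa [hP'] at this
  have htr : ∑ z, ((1 - P) * ρ z * (1 - P)).trace = 0 := by
    rw [← trace_sum, ← Finset.sum_mul, ← Finset.mul_sum, h, trace_zero]
  have h0 := (Finset.sum_eq_zero_iff_of_nonneg fun z _ => (hpos z).trace_nonneg).1 htr z
    (Finset.mem_univ z)
  have h1 : ρ z * (1 - P) = 0 := by
    refine mul_eq_zero_of_conj_eq_zero (hρ z) ?_
    rw [hP']
    exact (hpos z).trace_eq_zero_iff.1 h0
  have h2 : ρ z * P = ρ z := by
    rw [Matrix.mul_sub, Matrix.mul_one, sub_eq_zero] at h1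
    exact h1.symm
  have h3 : P * ρ z = ρ z := by
    have := congrArg conjTranspose h2
    rwa [conjTranspose_mul, hP.eq, (hρ z).1.eq] at this
  rw [h3, h2]

/-- With `T` the pseudo-inverse of `Q = σ^{1/4}`, cyclicity gives `Tr (TρT)² = Tr (T²ρT²)ρ`. The
right side is the weight with which the pretty good measurement `T²ρT²` identifies `ρ`. -/
theorem exists_prettyGood {Z : Type*} [Fintype Z] [DecidableEq Z] [Nonempty Z]
    {ρ : Z → Matrix E E ℂ} (hρ : ∀ z, (ρ z).PosSemidef) :
    ∃ (Q : Matrix E E ℂ) (B M : Z → Matrix E E ℂ), Q.IsHermitian ∧ (∀ z, (B z).PosSemidef) ∧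
      (∀ z, Q * B z * Q = ρ z) ∧ Q * Q * (Q * Q) = ∑ z, ρ z ∧ IsPOVM M ∧
      ∑ z, (B z * B z).trace.re ≤ ∑ z, (M z * ρ z).trace.re := by
  obtain ⟨z₀⟩ := ‹Nonempty Z›
  have hσ : (∑ z, ρ z).PosSemidef := posSemidef_sum _ fun z _ => hρ z
  have h0 := hσ.eigenvalues_nonneg
  have hid := spectralMap_id hσ.1
  set L := spectralMap hσ.1
  set Q := L (fun x => √√x) with hQ
  set T := L (fun x => (√√x)⁻¹) with hT
  set P := L (fun x => √√x * (√√x)⁻¹) with hP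
  have hTH : Tᴴ = T := spectralMap_isHermitian _ _
  have hQT : Q * T = P := spectralMap_mul _ _ _
  have hTQ : T * Q = P := by
    rw [hT, hQ, spectralMap_mul]
    simp only [mul_comm, hP, L]
  have hPH : P.IsHermitian := spectralMap_isHermitian _ _
  have hdich : ∀ i, (√√(hσ.1.eigenvalues i) = 0 ∧ hσ.1.eigenvalues i = 0) ∨
      (0 < √√(hσ.1.eigenvalues i) ∧
        (√√(hσ.1.eigenvalues i)) ^ 4 = hσ.1.eigenvalues i) := fun i => by
    rcases (h0 i).eq_or_lt with h | h
    · left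
      simp [← h]
    · right
      refine ⟨Real.sqrt_pos.2 (Real.sqrt_pos.2 h), ?_⟩
      rw [show 4 = 2 * 2 from rfl, pow_mul, Real.sq_sqrt (Real.sqrt_nonneg _),
        Real.sq_sqrt (h0 i)]
  have hPP : P * P = P := by
    rw [hP, spectralMap_mul]
    refine spectralMap_congr _ fun i => ?_
    rcases hdich i with ⟨h, -⟩ | ⟨h, -⟩
    · simp [h]
    · field_simp
  have hker : (1 - P) * (∑ z, ρ z) * (1 - P) = 0 := by
    have h1 : (1 - P) = L fun x => 1 - √√x * (√√x)⁻¹ := by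
      rw [← spectralMap_one hσ.1, hP, spectralMap_sub]
    have h2 : (1 - P) * (∑ z, ρ z) * (1 - P) = (1 - P) * L (fun x => x) * (1 - P) := by
      rw [hid]
    rw [h2, h1, spectralMap_mul, spectralMap_mul]
    calc L _ = L (fun _ => 0) := spectralMap_congr _ fun i => by
          rcases hdich i with ⟨h, h'⟩ | ⟨h, h'⟩
          · simp [h']
          · field_simp
            simp
      _ = 0 := by simp [L, spectralMap]
  have hB : ∀ z, (T * ρ z * T).PosSemidef := fun z => by
    have := (hρ z).conjTranspose_mul_mul_same T
    rwa [hTH] at this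
  have hTT : (T * T)ᴴ = T * T := by rw [conjTranspose_mul, hTH]
  have hTT' : ∀ z, (T * T * ρ z * (T * T)).PosSemidef := fun z => by
    have := (hρ z).conjTranspose_mul_mul_same (T * T)
    rwa [hTT] at this
  have hcompl := posSemidef_one_sub_of_idempotent hPH hPP
  refine ⟨Q, fun z => T * ρ z * T,
    -- The operators `T²ρT²` sum only to the support projector `P`; its complement is given to an
    -- arbitrary outcome, which cannot lower the success weight.
    fun z => T * T * ρ z * (T * T) + if z = z₀ then 1 - P else 0,
    spectralMap_isHermitian _ _, hB, fun z => ?_, ?_, ⟨fun z => ?_, ?_⟩, ?_⟩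
  · calc Q * (T * ρ z * T) * Q = (Q * T) * ρ z * (T * Q) := by simp only [Matrix.mul_assoc]
      _ = ρ z := by rw [hQT, hTQ, conj_eq_self_of_sum hρ hPH hker]
  · conv_rhs => rw [← hid]
    rw [hQ, spectralMap_mul, spectralMap_mul]
    refine spectralMap_congr _ fun i => ?_
    rw [Real.mul_self_sqrt (Real.sqrt_nonneg _), Real.mul_self_sqrt (h0 i)]
  · refine (hTT' z).add ?_
    split_ifs
    · exact hcompl
    · exact PosSemidef.zero
  · rw [Finset.sum_add_distrib, ← Finset.sum_mul, ← Finset.mul_sum,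
      Finset.sum_ite_eq' _ z₀, if_pos (Finset.mem_univ z₀)]
    have h1 : T * T * (∑ z, ρ z) * (T * T) = P := by
      have h2 : T * T * (∑ z, ρ z) * (T * T) = T * T * L (fun x => x) * (T * T) := by
        rw [hid]
      rw [h2, hT, spectralMap_mul, spectralMap_mul, spectralMap_mul]
      refine spectralMap_congr _ fun i => ?_
      rcases hdich i with ⟨h, -⟩ | ⟨h, h'⟩
      · simp [h]
      · have h3 := h'
        set y := √√(hσ.1.eigenvalues i)
        rw [← h3]
        field_simp
    rw [h1, add_sub_cancel]
  · refine Finset.sum_le_sum fun z _ => ?_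
    rw [Matrix.add_mul, trace_add, Complex.add_re]
    have h1 : (T * ρ z * T * (T * ρ z * T)).trace = (T * T * ρ z * (T * T) * ρ z).trace := by
      calc _ = (T * (ρ z * T * (T * ρ z * T))).trace := by simp only [Matrix.mul_assoc]
        _ = _ := trace_mul_comm _ _
        _ = ((ρ z * (T * T) * ρ z) * (T * T)).trace := by simp only [Matrix.mul_assoc]
        _ = _ := trace_mul_comm _ _
        _ = _ := by simp only [Matrix.mul_assoc]
    rw [h1, le_add_iff_nonneg_right]
    split_ifs
    · exact re_trace_mul_nonneg hcompl (hρ z)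
    · simp

end PrettyGood

/-! ### Guessing probabilities -/

section Guess

variable {E : Type*} [Fintype E] [DecidableEq E] {Z : Type*} [Fintype Z]

theorem IsPOVM.re_trace_mul_le [DecidableEq Z] {M : Z → Matrix E E ℂ} (hM : IsPOVM M) (z : Z)
    {ρ : Matrix E E ℂ} (hρ : ρ.PosSemidef) : (M z * ρ).trace.re ≤ ρ.trace.re := by
  have h1 : ρ.trace.re = ∑ y, (M y * ρ).trace.re := by
    rw [← Complex.re_sum, ← trace_sum, ← Finset.sum_mul, hM.sum_eq_one, Matrix.one_mul]
  rw [h1]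
  exact Finset.single_le_sum (f := fun y => (M y * ρ).trace.re)
    (fun y _ => re_trace_mul_nonneg (hM.posSemidef y) hρ) (Finset.mem_univ z)

/-- A real supremum is meaningful only for a bounded family, so lower bounds on `guessProb` need
this too. -/
theorem bddAbove_guess [DecidableEq Z] {P : Z → ℝ} (hP : ∀ z, 0 ≤ P z)
    {ρ : Z → Matrix E E ℂ} (hρ : ∀ z, (ρ z).PosSemidef) :
    ∀ M : {M : Z → Matrix E E ℂ // IsPOVM M},
      ∑ z, P z * ((M.1 z * ρ z).trace).re ≤ ∑ z, P z * (ρ z).trace.re := fun M =>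
  Finset.sum_le_sum fun z _ =>
    mul_le_mul_of_nonneg_left (M.2.re_trace_mul_le z (hρ z)) (hP z)

theorem le_guessProb [DecidableEq Z] {P : Z → ℝ} (hP : ∀ z, 0 ≤ P z)
    {ρ : Z → Matrix E E ℂ} (hρ : ∀ z, (ρ z).PosSemidef) {M : Z → Matrix E E ℂ}
    (hM : IsPOVM M) : ∑ z, P z * ((M z * ρ z).trace).re ≤ guessProb P ρ :=
  le_ciSup (f := fun M : {M : Z → Matrix E E ℂ // IsPOVM M} =>
    ∑ z, P z * ((M.1 z * ρ z).trace).re)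
    ⟨_, Set.forall_mem_range.2 (bddAbove_guess hP hρ)⟩ ⟨M, hM⟩

theorem isPOVM_pi_single [DecidableEq Z] (z₀ : Z) :
    IsPOVM fun z => if z = z₀ then (1 : Matrix E E ℂ) else 0 where
  posSemidef z := by
    split_ifs
    · exact PosSemidef.one
    · exact PosSemidef.zero
  sum_eq_one := by simp

end Guess

/-! ### Superoperators applied to the encoded bits -/

section Channel

theorem bb84_posSemidef (z : ZMod 2) (b : Basis) : (bb84 z b).PosSemidef := by
  have h : bb84 z b = (bb84 z b)ᴴ * bb84 z b := by
    cases b <;> simp only [bb84] <;> split_ifs <;> ext i j <;> fin_cases i <;> fin_cases j <;>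
      simp [Matrix.mul_apply, Fin.sum_univ_two, Complex.conj_ofNat] <;> norm_num
  rw [h]
  exact posSemidef_conjTranspose_mul_self _

theorem trace_bb84 (z : ZMod 2) (b : Basis) : (bb84 z b).trace = 1 := by
  cases b <;> simp only [bb84] <;> split_ifs <;> simp [Matrix.trace, Fin.sum_univ_two] <;> norm_num

variable {a b : Type*} [Fintype a] [Fintype b] {Φ : Matrix a a ℂ →ₗ[ℂ] Matrix b b ℂ}

/-- Complete positivity with a one-dimensional ancilla. -/
theorem IsSuperoperator.posSemidef (hΦ : IsSuperoperator Φ) {A : Matrix a a ℂ}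
    (hA : A.PosSemidef) : (Φ A).PosSemidef :=
  (hΦ.completelyPositive 1 (A.submatrix Prod.snd Prod.snd) (hA.submatrix _)).submatrix
    fun i => ((0 : Fin 1), i)

variable {k : ℕ} {S : Matrix (Fin 2) (Fin 2) ℂ →ₗ[ℂ] Matrix (Fin k) (Fin k) ℂ}

theorem IsSuperoperator.trace_bb84 (hS : IsSuperoperator S) (z : ZMod 2) (b : Basis) :
    (S (bb84 z b)).trace = 1 := by
  rw [hS.tracePreserving, NoisyStorage.trace_bb84]

theorem IsSuperoperator.bb84_posSemidef (hS : IsSuperoperator S) (z : ZMod 2) (b : Basis) :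
    (S (bb84 z b)).PosSemidef :=
  hS.posSemidef (NoisyStorage.bb84_posSemidef z b)

/-- Always answering `0` is right half of the time. -/
theorem half_le_bitGuessProb (hS : IsSuperoperator S) (b : Basis) :
    1 / 2 ≤ bitGuessProb S b := by
  refine le_trans (le_of_eq ?_) (le_guessProb (fun _ => by norm_num)
    (fun z => hS.bb84_posSemidef z b) (isPOVM_pi_single (0 : ZMod 2)))
  rw [Finset.sum_eq_single (0 : ZMod 2)]
  · simp [hS.trace_bb84]
  · intro z _ hz
    simp [hz]
  · simp

theorem bitGuessProb_le_one (hS : IsSuperoperator S) (b : Basis) : bitGuessProb S b ≤ 1 := by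
  have : Nonempty {M : ZMod 2 → Matrix (Fin k) (Fin k) ℂ // IsPOVM M} :=
    ⟨⟨_, isPOVM_pi_single 0⟩⟩
  refine ciSup_le fun M => (bddAbove_guess (fun _ => by norm_num)
    (fun z => hS.bb84_posSemidef z b) M).trans (le_of_eq ?_)
  simp [hS.trace_bb84, ZMod.card]

theorem exists_factor_univ (hS : IsSuperoperator S) (b : Basis) :
    ∃ (Q : Matrix (Fin k) (Fin k) ℂ) (B : ZMod 2 → Matrix (Fin k) (Fin k) ℂ),
      Q.IsHermitian ∧ (∀ z, (B z).PosSemidef) ∧ (∀ z, Q * B z * Q = S (bb84 z b)) ∧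
      (Q * Q * (Q * Q)).trace = 2 ∧
      ∑ z, (B z * B z).trace.re ≤ 2 * bitGuessProb S b := by
  obtain ⟨Q, B, M, hQ, hB, hQB, hQ4, hM, hle⟩ :=
    exists_prettyGood (fun z => hS.bb84_posSemidef z b)
  refine ⟨Q, B, hQ, hB, hQB, ?_, ?_⟩
  · rw [hQ4, trace_sum]
    simp [hS.trace_bb84, ZMod.card]
  · have := le_guessProb (P := fun _ => 1 / 2) (fun _ => by norm_num)
      (fun z => hS.bb84_posSemidef z b) hM
    rw [← Finset.mul_sum] at this
    unfold bitGuessProb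
    linarith

/-- Used at positions whose bit is fixed: a one-element family contributes only factors at most `1`,
so these positions fit into the same tensor product. -/
theorem exists_factor_singleton {E : Type*} [Fintype E] [DecidableEq E] {ρ : Matrix E E ℂ}
    (hρ : ρ.PosSemidef) (htr : ρ.trace = 1) :
    ∃ Q B : Matrix E E ℂ, Q.IsHermitian ∧ B.PosSemidef ∧ Q * B * Q = ρ ∧
      (Q * Q * (Q * Q)).trace = 1 ∧ (B * B).trace.re ≤ 1 := by
  obtain ⟨Q, B, M, hQ, hB, hQB, hQ4, hM, hle⟩ := exists_prettyGood (fun _ : Unit => hρ)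
  refine ⟨Q, B (), hQ, hB (), hQB (), ?_, ?_⟩
  · rw [hQ4]
    simpa using htr
  · have := hM.re_trace_mul_le () hρ
    simp only [Finset.univ_unique, Finset.sum_singleton] at hle
    rw [htr, Complex.one_re] at this
    exact hle.trans this

end Channel

/-! ### Tensor products -/

section Tensor

variable {n : ℕ} {d : Fin n → ℕ}

theorem tensor_mul (A B : ∀ i, Matrix (Fin (d i)) (Fin (d i)) ℂ) :
    tensor A * tensor B = tensor fun i => A i * B i := by
  ext x y
  simp only [tensor, Matrix.mul_apply, Matrix.of_apply, ← Finset.prod_mul_distrib]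
  rw [Finset.prod_univ_sum, Fintype.piFinset_univ]

theorem trace_tensor (A : ∀ i, Matrix (Fin (d i)) (Fin (d i)) ℂ) :
    (tensor A).trace = ∏ i, (A i).trace := by
  simp only [tensor, Matrix.trace, Matrix.diag_apply, Matrix.of_apply]
  rw [Finset.prod_univ_sum, Fintype.piFinset_univ]

theorem conjTranspose_tensor (A : ∀ i, Matrix (Fin (d i)) (Fin (d i)) ℂ) :
    (tensor A)ᴴ = tensor fun i => (A i)ᴴ := by
  ext x y
  simp [tensor, Matrix.conjTranspose_apply]

theorem tensor_isHermitian {A : ∀ i, Matrix (Fin (d i)) (Fin (d i)) ℂ}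
    (hA : ∀ i, (A i).IsHermitian) : (tensor A).IsHermitian := by
  rw [IsHermitian, conjTranspose_tensor]
  simp only [(hA _).eq]

theorem tensor_posSemidef {A : ∀ i, Matrix (Fin (d i)) (Fin (d i)) ℂ}
    (hA : ∀ i, (A i).PosSemidef) : (tensor A).PosSemidef := by
  choose C hC using fun i => exists_conjTranspose_mul_self (hA i)
  have : tensor A = (tensor C)ᴴ * tensor C := by
    rw [conjTranspose_tensor, tensor_mul]
    exact congrArg tensor (funext hC)
  rw [this]
  exact posSemidef_conjTranspose_mul_self _

theorem trace_mul_self_eq_re {E : Type*} [Fintype E] {B : Matrix E E ℂ} (hB : B.PosSemidef) :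
    (B * B).trace = ((B * B).trace.re : ℂ) := by
  have h := (posSemidef_conjTranspose_mul_self B).trace_nonneg
  rw [hB.1.eq] at h
  exact Complex.ext rfl (Complex.le_def.1 h).2.symm

theorem re_trace_tensor_mul_self {B : ∀ i, Matrix (Fin (d i)) (Fin (d i)) ℂ}
    (hB : ∀ i, (B i).PosSemidef) :
    (tensor B * tensor B).trace.re = ∏ i, (B i * B i).trace.re := by
  rw [tensor_mul, trace_tensor, Finset.prod_congr rfl fun i _ => trace_mul_self_eq_re (hB i),
    ← Complex.ofReal_prod, Complex.ofReal_re]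

end Tensor

/-! ### Privacy amplification -/

section Hashing

theorem trace_proj_mul_proj {𝒳 : Type*} [Fintype 𝒳] [DecidableEq 𝒳] (x y : 𝒳) :
    (proj x * proj y).trace = ((if x = y then 1 else 0 : ℝ) : ℂ) := by
  unfold proj
  split_ifs with h
  · subst h
    simp
  · simp [h]

theorem trace_proj {𝒳 : Type*} [Fintype 𝒳] [DecidableEq 𝒳] (x : 𝒳) : (proj x).trace = 1 := by
  simp [proj]

theorem proj_isHermitian {𝒳 : Type*} [DecidableEq 𝒳] (x : 𝒳) : (proj x).IsHermitian := by
  simp [proj, IsHermitian]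

/-- Averaged over the hash function, this becomes the collision probability minus `1/|𝒮|`, which
two-universality makes nonpositive for distinct inputs. -/
theorem trace_uniform_sub_proj_mul {𝒮 : Type*} [Fintype 𝒮] [DecidableEq 𝒮] [Nonempty 𝒮]
    (s t : 𝒮) :
    (((Fintype.card 𝒮 : ℂ)⁻¹ • (1 : Matrix 𝒮 𝒮 ℂ) - proj s) *
      ((Fintype.card 𝒮 : ℂ)⁻¹ • (1 : Matrix 𝒮 𝒮 ℂ) - proj t)).trace =
      (((if s = t then 1 else 0) - (Fintype.card 𝒮 : ℝ)⁻¹ : ℝ) : ℂ) := by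
  have h : (Fintype.card 𝒮 : ℂ) ≠ 0 := by simp
  rw [Matrix.sub_mul, Matrix.mul_sub, Matrix.mul_sub, trace_sub, trace_sub, trace_sub,
    trace_proj_mul_proj]
  simp only [Matrix.smul_mul, Matrix.mul_smul, Matrix.one_mul, Matrix.mul_one, trace_smul,
    trace_one, trace_proj, smul_eq_mul]
  push_cast
  field_simp
  ring

/-- The projector onto the span of the standard basis vectors in `W`. -/
def indicatorMatrix {𝒱 : Type*} [DecidableEq 𝒱] (W : Finset 𝒱) : Matrix 𝒱 𝒱 ℂ :=
  diagonal fun v => if v ∈ W then 1 else 0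

section Indicator

variable {𝒱 : Type*} [DecidableEq 𝒱] (W : Finset 𝒱)

theorem indicatorMatrix_isHermitian : (indicatorMatrix W).IsHermitian := by
  rw [IsHermitian, indicatorMatrix, diagonal_conjTranspose]
  congr 1
  ext v
  simp

variable [Fintype 𝒱]

theorem indicatorMatrix_mul_self : indicatorMatrix W * indicatorMatrix W = indicatorMatrix W := by
  simp [indicatorMatrix, diagonal_mul_diagonal]

theorem trace_indicatorMatrix : (indicatorMatrix W).trace = W.card := by
  simp [indicatorMatrix, trace_diagonal]

theorem indicatorMatrix_conj_proj {v : 𝒱} (hv : v ∈ W) :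
    indicatorMatrix W * proj v * indicatorMatrix W = proj v := by
  ext a b
  simp only [indicatorMatrix, proj, diagonal_mul, mul_diagonal, single_apply]
  by_cases h : v = a ∧ v = b
  · obtain ⟨rfl, rfl⟩ := h
    simp [hv]
  · simp [h]

end Indicator

variable {𝒮 𝒰 𝒱 α X E : Type*} [Fintype 𝒮] [DecidableEq 𝒮] [Nonempty 𝒮] [Fintype 𝒰]
  [DecidableEq 𝒰] [Fintype 𝒱] [DecidableEq 𝒱] [DecidableEq α] [DecidableEq X] [Fintype E]
  [DecidableEq E]

omit [DecidableEq 𝒰] [Fintype 𝒱] [DecidableEq α] [DecidableEq X] in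
theorem card_image_view_le {𝓕 : Finset α} {𝒳 : Finset X} {u : X → 𝒰} {view : α → X → 𝒱}
    (hview : ∀ f ∈ 𝓕, ∀ x ∈ 𝒳, ∀ f' ∈ 𝓕, ∀ x' ∈ 𝒳, view f x = view f' x' ↔ f = f' ∧ u x = u x') :
    ((𝓕 ×ˢ 𝒳).image fun p => view p.1 p.2).card ≤ 𝓕.card * Fintype.card 𝒰 := by
  set W := (𝓕 ×ˢ 𝒳).image fun p => view p.1 p.2
  have hW : ∀ v : W, ∃ p ∈ 𝓕 ×ˢ 𝒳, view p.1 p.2 = v := fun v => Finset.mem_image.1 v.2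
  choose p hp hpv using hW
  have hcard : (𝓕 ×ˢ (Finset.univ : Finset 𝒰)).card = 𝓕.card * Fintype.card 𝒰 := by
    rw [Finset.card_product, Finset.card_univ]
  rw [← hcard, ← Finset.card_attach]
  refine Finset.card_le_card_of_injOn (fun v => ((p v).1, u (p v).2)) (fun v _ => ?_) ?_
  · simpa using (Finset.mem_product.1 (hp v)).1
  · intro v _ w _ h
    simp only [Prod.mk.injEq] at h
    have hv := Finset.mem_product.1 (hp v)
    have hw := Finset.mem_product.1 (hp w)
    have := (hview _ hv.1 _ hv.2 _ hw.1 _ hw.2).2 h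
    rw [hpv, hpv] at this
    exact Subtype.ext this

omit [DecidableEq 𝒮] [Nonempty 𝒮] [Fintype 𝒰] in
-- Summed over `f`, the coefficient of each pair `x ≠ x'` is nonpositive and multiplies a
-- nonnegative number, so only the diagonal remains, with coefficient at most `1` per `f`.
theorem sum_collision_le [DecidableEq 𝒮] {𝓕 : Finset α} {𝒳 : Finset X} {out : α → X → 𝒮}
    {u : X → 𝒰} {t : X → X → ℝ}
    (hcoll : ∀ x ∈ 𝒳, ∀ x' ∈ 𝒳, x ≠ x' →
      ((𝓕.filter fun f => out f x = out f x').card : ℝ) ≤ 𝓕.card * (Fintype.card 𝒮 : ℝ)⁻¹)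
    (ht : ∀ x ∈ 𝒳, ∀ x' ∈ 𝒳, 0 ≤ t x x') :
    ∑ p ∈ 𝓕 ×ˢ 𝒳, ∑ q ∈ 𝓕 ×ˢ 𝒳, (if p.1 = q.1 then
      ((if out p.1 p.2 = out q.1 q.2 then 1 else 0) - (Fintype.card 𝒮 : ℝ)⁻¹) *
        ((if u p.2 = u q.2 then 1 else 0) * t p.2 q.2) else 0) ≤
      𝓕.card * ∑ x ∈ 𝒳, t x x := by
  have h1 : ∀ f ∈ 𝓕, ∀ x, ∑ q ∈ 𝓕 ×ˢ 𝒳, (if f = q.1 then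
      ((if out f x = out q.1 q.2 then 1 else 0) - (Fintype.card 𝒮 : ℝ)⁻¹) *
        ((if u x = u q.2 then 1 else 0) * t x q.2) else 0) =
      ∑ x' ∈ 𝒳, ((if out f x = out f x' then 1 else 0) - (Fintype.card 𝒮 : ℝ)⁻¹) *
        ((if u x = u x' then 1 else 0) * t x x') := by
    intro f hf x
    rw [Finset.sum_product, Finset.sum_eq_single_of_mem f hf]
    · simp
    · intro g _ hg
      simp [hg.symm]
  have h2 : ∀ x ∈ 𝒳, ∀ x' ∈ 𝒳,
      ∑ f ∈ 𝓕, ((if out f x = out f x' then 1 else 0) - (Fintype.card 𝒮 : ℝ)⁻¹) *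
        ((if u x = u x' then 1 else 0) * t x x') ≤
      if x = x' then 𝓕.card * t x x' else 0 := by
    intro x hx x' hx'
    rw [← Finset.sum_mul, Finset.sum_sub_distrib, Finset.sum_const, nsmul_eq_mul,
      Finset.sum_boole]
    by_cases h : x = x'
    · subst h
      have : 0 ≤ (𝓕.card : ℝ) * (Fintype.card 𝒮 : ℝ)⁻¹ := by positivity
      simp only [Finset.filter_true, if_true, one_mul]
      exact mul_le_mul_of_nonneg_right (by linarith) (ht x hx x hx)
    · rw [if_neg h]
      refine mul_nonpos_of_nonpos_of_nonneg (sub_nonpos.2 (hcoll x hx x' hx' h)) ?_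
      have := ht x hx x' hx'
      positivity
  calc _ = ∑ f ∈ 𝓕, ∑ x ∈ 𝒳, ∑ x' ∈ 𝒳,
        ((if out f x = out f x' then 1 else 0) - (Fintype.card 𝒮 : ℝ)⁻¹) *
          ((if u x = u x' then 1 else 0) * t x x') := by
        rw [Finset.sum_product]
        exact Finset.sum_congr rfl fun f hf => Finset.sum_congr rfl fun x _ => h1 f hf x
    _ = ∑ x ∈ 𝒳, ∑ x' ∈ 𝒳, ∑ f ∈ 𝓕,
        ((if out f x = out f x' then 1 else 0) - (Fintype.card 𝒮 : ℝ)⁻¹) *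
          ((if u x = u x' then 1 else 0) * t x x') := by
        rw [Finset.sum_comm]
        exact Finset.sum_congr rfl fun x _ => Finset.sum_comm
    _ ≤ ∑ x ∈ 𝒳, ∑ x' ∈ 𝒳, if x = x' then 𝓕.card * t x x' else 0 :=
        Finset.sum_le_sum fun x hx => Finset.sum_le_sum fun x' hx' => h2 x hx x' hx'
    _ = _ := by
        rw [Finset.mul_sum]
        refine Finset.sum_congr rfl fun x hx => ?_
        rw [Finset.sum_ite_eq, if_pos hx]

theorem sqrt_mul_sqrt_le {a f k q t w b : ℝ} (ha : 0 ≤ a) (hf : 0 ≤ f) (hk : 0 ≤ k) (hw : 0 ≤ w)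
    (hq : 0 ≤ q) (ht : 0 ≤ t) (hwf : w ≤ f * k) (hb : b ≤ f * t) :
    √(a * w * q) * √b ≤ f * √(a * k * q * t) := by
  rw [← Real.sqrt_mul (by positivity)]
  refine Real.sqrt_le_iff.2 ⟨by positivity, ?_⟩
  rw [mul_pow, Real.sq_sqrt (by positivity)]
  calc a * w * q * b ≤ a * w * q * (f * t) := by gcongr
    _ ≤ a * (f * k) * q * (f * t) := by gcongr
    _ = _ := by ring

/-- The deviation of the hash values `out f x` from uniform, tested by `V` against the register
`view f x` and the quantum states `ρ x`. -/
theorem sum_re_trace_hash_le {V : Matrix (𝒮 × 𝒱 × E) (𝒮 × 𝒱 × E) ℂ} (hV : IsContraction V)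
    {𝓕 : Finset α} {𝒳 : Finset X} {out : α → X → 𝒮} {u : X → 𝒰} {view : α → X → 𝒱}
    (hview : ∀ f ∈ 𝓕, ∀ x ∈ 𝒳, ∀ f' ∈ 𝓕, ∀ x' ∈ 𝒳, view f x = view f' x' ↔ f = f' ∧ u x = u x')
    (hcoll : ∀ x ∈ 𝒳, ∀ x' ∈ 𝒳, x ≠ x' →
      ((𝓕.filter fun f => out f x = out f x').card : ℝ) ≤ 𝓕.card * (Fintype.card 𝒮 : ℝ)⁻¹)
    {Q : Matrix E E ℂ} {B ρ : X → Matrix E E ℂ} (hQ : Q.IsHermitian)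
    (hB : ∀ x ∈ 𝒳, (B x).PosSemidef) (hρ : ∀ x ∈ 𝒳, Q * B x * Q = ρ x) :
    ∑ f ∈ 𝓕, ∑ x ∈ 𝒳, (V * (((Fintype.card 𝒮 : ℂ)⁻¹ • (1 : Matrix 𝒮 𝒮 ℂ) - proj (out f x)) ⊗ₖ
        (proj (view f x) ⊗ₖ ρ x))).trace.re ≤
      𝓕.card * √(Fintype.card 𝒮 * Fintype.card 𝒰 * (Q * Q * (Q * Q)).trace.re *
        ∑ x ∈ 𝒳, (B x * B x).trace.re) := by
  set J : 𝒮 → Matrix 𝒮 𝒮 ℂ := fun s => (Fintype.card 𝒮 : ℂ)⁻¹ • (1 : Matrix 𝒮 𝒮 ℂ) - proj s with hJ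
  have hJH : ∀ s, (J s).IsHermitian := fun s => by
    refine IsHermitian.sub ?_ (proj_isHermitian s)
    simp [IsHermitian, conjTranspose_smul]
  set W := (𝓕 ×ˢ 𝒳).image fun p => view p.1 p.2
  set P := indicatorMatrix W
  -- Using `P` in place of the identity makes `Tr Q'⁴` count only the views that occur, at most `|𝓕|
  -- |𝒰|` of them.
  set Q' : Matrix (𝒮 × 𝒱 × E) (𝒮 × 𝒱 × E) ℂ := (1 : Matrix 𝒮 𝒮 ℂ) ⊗ₖ (P ⊗ₖ Q) with hQ'
  set B' : Matrix (𝒮 × 𝒱 × E) (𝒮 × 𝒱 × E) ℂ :=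
    ∑ f ∈ 𝓕, ∑ x ∈ 𝒳, J (out f x) ⊗ₖ (proj (view f x) ⊗ₖ B x) with hB'
  have hPH : P.IsHermitian := indicatorMatrix_isHermitian W
  have hQ'H : Q'.IsHermitian := by
    rw [IsHermitian, hQ', conjTranspose_kronecker, conjTranspose_kronecker, hPH.eq, hQ.eq,
      conjTranspose_one]
  have hB'H : B'.IsHermitian := by
    rw [IsHermitian, hB', conjTranspose_sum]
    refine Finset.sum_congr rfl fun f _ => ?_
    rw [conjTranspose_sum]
    refine Finset.sum_congr rfl fun x hx => ?_
    rw [conjTranspose_kronecker, conjTranspose_kronecker, (hJH _).eq, (hB x hx).1.eq,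
      (proj_isHermitian _).eq]
  have hsum : ∑ f ∈ 𝓕, ∑ x ∈ 𝒳, (V * (J (out f x) ⊗ₖ (proj (view f x) ⊗ₖ ρ x))).trace.re
      = (V * (Q' * B' * Q')).trace.re := by
    rw [hB']
    simp only [Finset.mul_sum, Finset.sum_mul, trace_sum, Complex.re_sum]
    refine Finset.sum_congr rfl fun f hf => Finset.sum_congr rfl fun x hx => ?_
    have hmem : view f x ∈ W :=
      Finset.mem_image.2 ⟨(f, x), Finset.mem_product.2 ⟨hf, hx⟩, rfl⟩
    rw [hQ', ← mul_kronecker_mul, ← mul_kronecker_mul, ← mul_kronecker_mul, ← mul_kronecker_mul,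
      Matrix.one_mul, Matrix.mul_one, indicatorMatrix_conj_proj W hmem, hρ x hx]
  have hQ4 : (Q' * Q' * (Q' * Q')).trace.re
      = Fintype.card 𝒮 * W.card * (Q * Q * (Q * Q)).trace.re := by
    have hPP : P * P = P := indicatorMatrix_mul_self W
    simp only [hQ', ← mul_kronecker_mul, Matrix.one_mul, hPP]
    rw [trace_kronecker, trace_kronecker, trace_one, trace_indicatorMatrix, ← mul_assoc,
      ← Nat.cast_mul, ← Complex.ofReal_natCast, Complex.re_ofReal_mul]
    push_cast
    rfl
  have hB2 : (B' * B').trace.re ≤ 𝓕.card * ∑ x ∈ 𝒳, (B x * B x).trace.re := by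
    refine le_trans (le_of_eq ?_) (sum_collision_le (out := out) (u := u)
      (t := fun x x' => (B x * B x').trace.re) hcoll
      fun x hx x' hx' => re_trace_mul_nonneg (hB x hx) (hB x' hx'))
    rw [hB', ← Finset.sum_product', Finset.sum_mul_sum, trace_sum, Complex.re_sum]
    refine Finset.sum_congr rfl fun p hp => ?_
    rw [trace_sum, Complex.re_sum]
    refine Finset.sum_congr rfl fun q hq => ?_
    obtain ⟨hf, hx⟩ := Finset.mem_product.1 hp
    obtain ⟨hf', hx'⟩ := Finset.mem_product.1 hq
    have hv := hview p.1 hf p.2 hx q.1 hf' q.2 hx'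
    rw [← mul_kronecker_mul, ← mul_kronecker_mul, trace_kronecker, trace_kronecker,
      trace_uniform_sub_proj_mul, trace_proj_mul_proj, Complex.re_ofReal_mul,
      Complex.re_ofReal_mul]
    by_cases h : p.1 = q.1
    · have hv' : view p.1 p.2 = view q.1 q.2 ↔ u p.2 = u q.2 := hv.trans (and_iff_right h)
      rw [if_pos h]
      simp only [hv']
    · simp only [hv, h, false_and, if_false, zero_mul, mul_zero]
  have hq : 0 ≤ (Q * Q * (Q * Q)).trace.re := by
    have := re_trace_nonneg (posSemidef_conjTranspose_mul_self (Q * Q))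
    rwa [conjTranspose_mul, hQ.eq] at this
  have ht : 0 ≤ ∑ x ∈ 𝒳, (B x * B x).trace.re :=
    Finset.sum_nonneg fun x hx => re_trace_mul_nonneg (hB x hx) (hB x hx)
  have hcard : (W.card : ℝ) ≤ 𝓕.card * Fintype.card 𝒰 := by
    exact_mod_cast card_image_view_le hview
  rw [hsum]
  refine (hV.re_trace_mul_le hQ'H hB'H).trans ?_
  rw [hQ4]
  exact sqrt_mul_sqrt_le (Nat.cast_nonneg _) (Nat.cast_nonneg _) (Nat.cast_nonneg _)
    (Nat.cast_nonneg _) hq ht hcard hB2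

end Hashing

/-! ### Averages over the bases for which Alice does not abort -/

section Window

variable {α : Type*} [Fintype α] [DecidableEq α]

theorem exists_perm_map_eq {J K : Finset α} (h : J.card = K.card) :
    ∃ π : Equiv.Perm α, J.map π.toEmbedding = K := by
  let e : {x // x ∈ J} ≃ {x // x ∈ K} := Finset.equivOfCardEq h
  refine ⟨e.extendSubtype, Finset.eq_of_subset_of_card_le (fun x hx => ?_) (by simp [h])⟩
  obtain ⟨y, hy, rfl⟩ := Finset.mem_map.1 hx
  exact e.extendSubtype_mem y hy

theorem sum_perm_prod_eq (p : α → ℝ) {J K : Finset α} (h : J.card = K.card) :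
    ∑ π : Equiv.Perm α, ∏ i ∈ J, p (π i) = ∑ π : Equiv.Perm α, ∏ i ∈ K, p (π i) := by
  obtain ⟨σ, rfl⟩ := exists_perm_map_eq h
  simp only [Finset.prod_map]
  exact (Equiv.sum_comp (Equiv.mulRight σ) fun π : Equiv.Perm α => ∏ i ∈ J, p (π i)).symm

/-- Discrete convexity: the sum over permutations depends only on the size of the set and is convex
in it, so a set and its complement contribute less the more balanced they are. -/
theorem sum_perm_prod_add_compl_le {p : α → ℝ} (h0 : ∀ i, 0 ≤ p i) (h1 : ∀ i, p i ≤ 1)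
    {I J : Finset α} (hI : J.card ≤ I.card) (hIc : J.card ≤ Iᶜ.card) :
    ∑ π : Equiv.Perm α, ∏ i ∈ I, p (π i) + ∑ π : Equiv.Perm α, ∏ i ∈ Iᶜ, p (π i) ≤
      ∑ π : Equiv.Perm α, ∏ i ∈ J, p (π i) + ∑ π : Equiv.Perm α, ∏ i ∈ Jᶜ, p (π i) := by
  obtain ⟨A, hAI, hA⟩ := Finset.exists_subset_card_eq hI
  obtain ⟨K, hKI, hK⟩ := Finset.exists_subset_card_eq hIc
  have hIK : Disjoint I K := (disjoint_compl_right (a := I)).mono_right hKI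
  have hAc : Jᶜ.card = Aᶜ.card := by rw [Finset.card_compl, Finset.card_compl, hA]
  have hdec : Aᶜ = (I \ A) ∪ Iᶜ := by
    ext x
    have := @hAI x
    simp only [Finset.mem_compl, Finset.mem_union, Finset.mem_sdiff]
    tauto
  have hdisj : Disjoint (I \ A) Iᶜ := disjoint_compl_right.mono_left Finset.sdiff_subset
  have hdisj' : Disjoint (I \ A) K := hIK.mono_left Finset.sdiff_subset
  have hKA : I.card = ((I \ A) ∪ K).card := by
    rw [Finset.card_union_of_disjoint hdisj', Finset.card_sdiff_of_subset hAI, hK, hA]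
    omega
  rw [sum_perm_prod_eq p hA.symm, sum_perm_prod_eq p hAc, hdec]
  have hAK := sum_perm_prod_eq p (hA.trans hK.symm)
  have hIK' := sum_perm_prod_eq p hKA
  -- With `D` the product over `I \ A`, the left side is `(1 - D)(∏_A - ∏_K)` and the right side is
  -- `(1 - D)(∏_A - ∏_{Iᶜ})`. Summed over `π` the left side vanishes, as the sets it compares have
  -- equal sizes.
  have key : ∀ π : Equiv.Perm α, (∏ i ∈ A, p (π i) - ∏ i ∈ K, p (π i)) -
      (∏ i ∈ I, p (π i) - ∏ i ∈ (I \ A) ∪ K, p (π i)) ≤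
      (∏ i ∈ A, p (π i) + ∏ i ∈ (I \ A) ∪ Iᶜ, p (π i)) -
        (∏ i ∈ I, p (π i) + ∏ i ∈ Iᶜ, p (π i)) := by
    intro π
    rw [Finset.prod_union hdisj, Finset.prod_union hdisj', ← Finset.prod_sdiff hAI]
    have hD : ∏ i ∈ I \ A, p (π i) ≤ 1 :=
      Finset.prod_le_one (fun i _ => h0 _) fun i _ => h1 _
    have hK' : ∏ i ∈ Iᶜ, p (π i) ≤ ∏ i ∈ K, p (π i) :=
      Finset.prod_le_prod_of_subset_of_le_one hKI (fun i _ => h0 _) fun i _ _ => h1 _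
    nlinarith
  have := Finset.sum_le_sum fun π (_ : π ∈ Finset.univ) => key π
  simp only [Finset.sum_sub_distrib, Finset.sum_add_distrib] at this
  linarith

/-- Every set in `W` is at least as balanced as every set outside. Since `W` is closed under
complements and permutations, summing the convexity inequality over all such pairs shows that the
mean over `W` is at most the mean over all sets, computed by expanding `∏ (1 + pᵢ)`. -/
theorem sum_window_mul_le {p : α → ℝ} (h0 : ∀ i, 0 ≤ p i) (h1 : ∀ i, p i ≤ 1) (τ : ℝ)
    {W : Finset (Finset α)} (hW : ∀ I, I ∈ W ↔ τ < I.card ∧ τ < Iᶜ.card) :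
    (∑ I ∈ W, ∏ i ∈ I, p i) ≤ W.card * ∏ i, (1 + p i) / 2 := by
  set s : Finset α → ℝ := fun J => ∑ π : Equiv.Perm α, ∏ i ∈ J, p (π i) with hs
  have hcompl : ∀ I, Iᶜ ∈ W ↔ I ∈ W := fun I => by rw [hW, hW, compl_compl, and_comm]
  have hle : ∀ I ∈ W, ∀ J ∈ Wᶜ, s I + s Iᶜ ≤ s J + s Jᶜ := by
    intro I hI J hJ
    obtain ⟨hI1, hI2⟩ := (hW I).1 hI
    rw [Finset.mem_compl, hW, not_and_or, not_lt, not_lt] at hJ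
    rcases hJ with hJ | hJ
    · exact sum_perm_prod_add_compl_le h0 h1 (by exact_mod_cast (hJ.trans hI1.le))
        (by exact_mod_cast (hJ.trans hI2.le))
    · have := sum_perm_prod_add_compl_le h0 h1 (I := I) (J := Jᶜ)
        (by exact_mod_cast (hJ.trans hI1.le)) (by exact_mod_cast (hJ.trans hI2.le))
      rw [compl_compl] at this
      simp only [hs]
      linarith
  have hinv : ∀ V : Finset (Finset α), (∀ I J, I ∈ V → I.card = J.card → J ∈ V) →
      ∑ I ∈ V, s I = (Fintype.card (Equiv.Perm α) : ℝ) * ∑ I ∈ V, ∏ i ∈ I, p i := by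
    intro V hV
    rw [hs, Finset.sum_comm, ← nsmul_eq_mul, ← Finset.card_univ, ← Finset.sum_const]
    refine Finset.sum_congr rfl fun π _ => ?_
    refine Finset.sum_bij' (fun I _ => I.map π.toEmbedding) (fun I _ => I.map π.symm.toEmbedding)
      (fun I hI => hV I _ hI (by simp)) (fun I hI => hV I _ hI (by simp)) ?_ ?_ ?_
    · intro I _
      ext x
      simp
    · intro I _
      ext x
      simp
    · intro I _
      simp
  have hWinv : ∀ I J, I ∈ W → I.card = J.card → J ∈ W := by
    intro I J hI h
    rw [hW, Finset.card_compl] at hI ⊢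
    rwa [← h]
  have hWinv' : ∀ I J, I ∈ Wᶜ → I.card = J.card → J ∈ Wᶜ := by
    intro I J hI h
    rw [Finset.mem_compl] at hI ⊢
    exact fun hJ => hI (hWinv J I hJ h.symm)
  have hsymm : ∀ V : Finset (Finset α), (∀ I, Iᶜ ∈ V ↔ I ∈ V) →
      ∑ I ∈ V, (s I + s Iᶜ) = 2 * ∑ I ∈ V, s I := by
    intro V hV
    rw [Finset.sum_add_distrib, two_mul]
    congr 1
    exact Finset.sum_bij' (fun I _ => Iᶜ) (fun I _ => Iᶜ) (fun I hI => (hV I).2 hI)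
      (fun I hI => (hV I).2 hI) (by simp) (by simp) (by simp)
  have hdouble := Finset.sum_le_sum fun I hI => Finset.sum_le_sum fun J hJ => hle I hI J hJ
  simp only [Finset.sum_const, nsmul_eq_mul] at hdouble
  rw [← Finset.mul_sum, hsymm W hcompl, hsymm Wᶜ (by simp [hcompl]), hinv W hWinv,
    hinv Wᶜ hWinv'] at hdouble
  have hfac : (0 : ℝ) < Fintype.card (Equiv.Perm α) := by
    exact_mod_cast Fintype.card_pos
  have hmain : (Wᶜ.card : ℝ) * ∑ I ∈ W, ∏ i ∈ I, p i ≤ W.card * ∑ I ∈ Wᶜ, ∏ i ∈ I, p i := by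
    refine le_of_mul_le_mul_left ?_ (mul_pos two_pos hfac)
    linarith
  have htot : ∑ I ∈ W, ∏ i ∈ I, p i + ∑ I ∈ Wᶜ, ∏ i ∈ I, p i = ∏ i, (1 + p i) := by
    rw [Finset.sum_add_sum_compl, Finset.prod_one_add, Finset.powerset_univ]
  have hcard : (W.card : ℝ) + Wᶜ.card = 2 ^ Fintype.card α := by
    exact_mod_cast (by rw [Finset.card_add_card_compl, Fintype.card_finset])
  rw [Finset.prod_div_distrib, Finset.prod_const, Finset.card_univ, ← mul_div_assoc,
    le_div_iff₀ (by positivity), ← hcard, ← htot]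
  linarith

end Window

/-! ### From subsets of the remaining positions to basis strings. -/

section Bases

theorem Basis.other_ne (b : Basis) : b.other ≠ b := by cases b <;> simp [Basis.other]

theorem Basis.eq_other_of_ne {b c : Basis} (h : b ≠ c) : b = c.other := by
  cases b <;> cases c <;> simp_all [Basis.other]

variable {n : ℕ} (R : Finset (Fin n))

/-- The remaining positions encoded in the basis `b`, as a set of elements of `R`. -/
def subtypeIndexSet (Θ : Fin n → Basis) (b : Basis) : Finset R :=
  Finset.univ.filter fun i => Θ i = b

theorem map_subtypeIndexSet (Θ : Fin n → Basis) (b : Basis) :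
    (subtypeIndexSet R Θ b).map (Function.Embedding.subtype _) = indexSet R Θ b := by
  ext i
  simp [subtypeIndexSet, indexSet, and_comm]

theorem card_subtypeIndexSet (Θ : Fin n → Basis) (b : Basis) :
    (subtypeIndexSet R Θ b).card = (indexSet R Θ b).card := by
  rw [← map_subtypeIndexSet, Finset.card_map]

theorem prod_subtypeIndexSet (Θ : Fin n → Basis) (b : Basis) (p : Fin n → ℝ) :
    ∏ i ∈ subtypeIndexSet R Θ b, p i = ∏ i ∈ indexSet R Θ b, p i := by
  rw [← map_subtypeIndexSet, Finset.prod_map]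
  rfl

theorem compl_subtypeIndexSet (Θ : Fin n → Basis) (b : Basis) :
    (subtypeIndexSet R Θ b)ᶜ = subtypeIndexSet R Θ b.other := by
  ext i
  simp only [subtypeIndexSet, Finset.mem_compl, Finset.mem_filter, Finset.mem_univ, true_and]
  exact ⟨Basis.eq_other_of_ne, fun h h' => b.other_ne (h.symm.trans h')⟩

theorem card_fiber_subtypeIndexSet (b : Basis) (I : Finset R) :
    (Finset.univ.filter fun Θ : Fin n → Basis => subtypeIndexSet R Θ b = I).card =
      ∏ i, if i ∈ R then 1 else Fintype.card Basis := by
  have h : (Finset.univ.filter fun Θ : Fin n → Basis => subtypeIndexSet R Θ b = I) =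
      Fintype.piFinset fun i => if h : i ∈ R then
        {if ⟨i, h⟩ ∈ I then b else b.other} else Finset.univ := by
    ext Θ
    rw [Finset.mem_filter, Fintype.mem_piFinset]
    simp only [Finset.mem_univ, true_and]
    constructor
    · rintro rfl i
      split_ifs with h1 h2
      · simpa [subtypeIndexSet] using h2
      · rw [Finset.mem_singleton]
        exact Basis.eq_other_of_ne (by simpa [subtypeIndexSet] using h2)
      · exact Finset.mem_univ _
    · intro hΘ
      ext ⟨i, hi⟩
      have := hΘ i
      rw [dif_pos hi, Finset.mem_singleton] at this
      simp only [subtypeIndexSet, Finset.mem_filter, Finset.mem_univ, true_and, this]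
      split_ifs with h <;> simp [h, Basis.other_ne]
  rw [h, Fintype.card_piFinset]
  refine Finset.prod_congr rfl fun i _ => ?_
  split_ifs <;> simp

theorem not_aborts_iff (τ : ℝ) (Θ : Fin n → Basis) (b : Basis) :
    ¬ Aborts R τ Θ ↔ τ < (subtypeIndexSet R Θ b).card ∧ τ < (subtypeIndexSet R Θ b)ᶜ.card := by
  rw [compl_subtypeIndexSet, card_subtypeIndexSet, card_subtypeIndexSet, Aborts]
  push Not
  refine ⟨fun h => ⟨h _, h _⟩, fun h c => ?_⟩
  by_cases hc : c = b
  · exact hc ▸ h.1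
  · exact Basis.eq_other_of_ne hc ▸ h.2

-- The map from `Θ` to its index set has fibres of equal size, the bases outside `R` being free. A
-- uniform accepted `Θ` therefore gives a uniform set in the window.
open Classical in
theorem sum_accepted_bases_le (τ : ℝ) (b : Basis) {p : Fin n → ℝ} (h0 : ∀ i, 0 ≤ p i)
    (h1 : ∀ i, p i ≤ 1) :
    ∑ Θ : Fin n → Basis with ¬ Aborts R τ Θ, ∏ i ∈ indexSet R Θ b, p i ≤
      ((Finset.univ.filter fun Θ : Fin n → Basis => ¬ Aborts R τ Θ).card : ℝ) *
        ∏ i ∈ R, (1 + p i) / 2 := by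
  set W : Finset (Finset R) :=
    Finset.univ.filter fun I => τ < (I.card : ℝ) ∧ τ < (Iᶜ.card : ℝ) with hW
  set N : ℕ := ∏ i : Fin n, if i ∈ R then 1 else Fintype.card Basis
  have hsum : ∀ g : Finset R → ℝ,
      ∑ Θ : Fin n → Basis with ¬ Aborts R τ Θ, g (subtypeIndexSet R Θ b) =
        N * ∑ I ∈ W, g I := by
    intro g
    rw [← Finset.sum_fiberwise_of_maps_to (t := W) (g := fun Θ => subtypeIndexSet R Θ b)
      (fun Θ hΘ => by
        simpa [hW, ← not_aborts_iff R τ Θ b] using hΘ), Finset.mul_sum]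
    refine Finset.sum_congr rfl fun I hI => ?_
    have hfib : (Finset.univ.filter fun Θ : Fin n → Basis => ¬ Aborts R τ Θ).filter
        (fun Θ => subtypeIndexSet R Θ b = I) =
        Finset.univ.filter fun Θ : Fin n → Basis => subtypeIndexSet R Θ b = I := by
      ext Θ
      simp only [Finset.mem_filter, Finset.mem_univ, true_and, and_iff_right_iff_imp]
      rintro rfl
      rw [not_aborts_iff R τ Θ b]
      exact (Finset.mem_filter.1 hI).2
    have hN : (N : ℝ) =
        (Finset.univ.filter fun Θ : Fin n → Basis => subtypeIndexSet R Θ b = I).card := by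
      rw [card_fiber_subtypeIndexSet]
    rw [hfib, hN, ← nsmul_eq_mul, ← Finset.sum_const]
    exact Finset.sum_congr rfl fun Θ hΘ => by rw [(Finset.mem_filter.1 hΘ).2]
  have hcard : ((Finset.univ.filter fun Θ : Fin n → Basis => ¬ Aborts R τ Θ).card : ℝ) =
      N * W.card := by
    simpa using hsum fun _ => 1
  have hprod := hsum fun I => ∏ i ∈ I, p i
  simp only [prod_subtypeIndexSet] at hprod
  rw [hprod, hcard, mul_assoc]
  refine mul_le_mul_of_nonneg_left ?_ (Nat.cast_nonneg _)
  have := sum_window_mul_le (p := fun i : R => p i) (fun i => h0 i) (fun i => h1 i) τ (W := W)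
    (by simp [hW])
  rwa [← Finset.prod_coe_sort R fun i => (1 + p i) / 2]

end Bases

/-! ### Bounds by the uncertainty quantity -/

section Uncertainty

theorem half_rpow_logb : (1 / 2 : ℝ) ^ Real.logb 2 (4 / 3) = 3 / 4 := by
  rw [one_div, Real.inv_rpow two_pos.le, Real.rpow_logb two_pos (by norm_num) (by norm_num)]
  norm_num

theorem logb_four_thirds_mem : 0 ≤ Real.logb 2 (4 / 3) ∧ Real.logb 2 (4 / 3) ≤ 1 := by
  refine ⟨Real.logb_nonneg (by norm_num) (by norm_num), ?_⟩
  rw [Real.logb_le_iff_le_rpow (by norm_num) (by norm_num)]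
  norm_num

/-- The left side is the chord of the concave right side between `1/2` and `1`; this fixes the
exponent `log(4/3)`. -/
theorem one_add_div_two_le_rpow {p : ℝ} (h : 1 / 2 ≤ p) (h1 : p ≤ 1) :
    (1 + p) / 2 ≤ p ^ Real.logb 2 (4 / 3) := by
  have hconc := (Real.concaveOn_rpow logb_four_thirds_mem.1 logb_four_thirds_mem.2).2
  have hc := hconc (show (1 / 2 : ℝ) ∈ Set.Ici 0 by simp) (show (1 : ℝ) ∈ Set.Ici 0 by simp)
    (show 0 ≤ 2 - 2 * p by linarith) (show 0 ≤ 2 * p - 1 by linarith) (by ring)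
  simp only [smul_eq_mul, half_rpow_logb, Real.one_rpow] at hc
  rw [show (2 - 2 * p) * (1 / 2) + (2 * p - 1) * 1 = p by ring] at hc
  linarith

variable {n : ℕ} {d : Fin n → ℕ} (R : Finset (Fin n))
  (S : ∀ i, Matrix (Fin 2) (Fin 2) ℂ →ₗ[ℂ] Matrix (Fin (d i)) (Fin (d i)) ℂ)

theorem Delta_le_deltaMax {i : Fin n} (hi : i ∈ R) : Delta (S i) ≤ deltaMax R S :=
  le_ciSup (f := fun j : R => Delta (S j)) (Set.finite_range _).bddAbove ⟨i, hi⟩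

theorem deltaMax_nonneg : 0 ≤ deltaMax R S :=
  Real.iSup_nonneg fun _ => Real.sqrt_nonneg _

theorem prod_bitGuessProb_other_le :
    ∏ i ∈ R, bitGuessProb (S i) (choiceBit R S).other ≤
      ∏ i ∈ R, bitGuessProb (S i) (choiceBit R S) := by
  unfold choiceBit
  split_ifs with h
  · exact h
  · exact (not_le.1 h).le

variable {S} (hS : ∀ i, IsSuperoperator (S i))
include hS

theorem prod_bitGuessProb_le_deltaMax :
    ∏ i ∈ R, bitGuessProb (S i) (choiceBit R S).other ≤ deltaMax R S ^ R.card := by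
  have hpos : ∀ i b, 0 ≤ bitGuessProb (S i) b := fun i b =>
    le_trans (by norm_num) (half_le_bitGuessProb (hS i) b)
  refine le_of_sq_le_sq ?_ (pow_nonneg (deltaMax_nonneg R S) _)
  calc (∏ i ∈ R, bitGuessProb (S i) (choiceBit R S).other) ^ 2
      ≤ (∏ i ∈ R, bitGuessProb (S i) (choiceBit R S).other) *
        ∏ i ∈ R, bitGuessProb (S i) (choiceBit R S) := by
        rw [sq]
        exact mul_le_mul_of_nonneg_left (prod_bitGuessProb_other_le R S)
          (Finset.prod_nonneg fun i _ => hpos i _)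
    _ = ∏ i ∈ R, Delta (S i) ^ 2 := by
        rw [← Finset.prod_mul_distrib]
        refine Finset.prod_congr rfl fun i _ => ?_
        rw [Delta, Real.sq_sqrt (mul_nonneg (hpos i _) (hpos i _))]
        cases choiceBit R S
        · exact mul_comm _ _
        · rfl
    _ ≤ ∏ i ∈ R, deltaMax R S ^ 2 :=
        Finset.prod_le_prod (fun i _ => sq_nonneg _) fun i hi =>
          pow_le_pow_left₀ (Real.sqrt_nonneg _) (Delta_le_deltaMax R S hi) 2
    _ = (deltaMax R S ^ R.card) ^ 2 := by rw [Finset.prod_const, ← pow_mul, ← pow_mul, mul_comm]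

theorem sqrt_prod_one_add_div_two_le :
    √(∏ i ∈ R, (1 + bitGuessProb (S i) (choiceBit R S).other) / 2) ≤
      deltaMax R S ^ (Real.logb 2 (4 / 3) / 2 * R.card) := by
  have hΔ := deltaMax_nonneg R S
  have hpos : ∀ i b, 0 ≤ bitGuessProb (S i) b := fun i b =>
    le_trans (by norm_num) (half_le_bitGuessProb (hS i) b)
  refine Real.sqrt_le_iff.2 ⟨Real.rpow_nonneg hΔ _, ?_⟩
  calc _ ≤ ∏ i ∈ R, bitGuessProb (S i) (choiceBit R S).other ^ Real.logb 2 (4 / 3) :=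
        Finset.prod_le_prod (fun i _ => by linarith [hpos i (choiceBit R S).other])
          fun i _ => one_add_div_two_le_rpow (half_le_bitGuessProb (hS i) _)
            (bitGuessProb_le_one (hS i) _)
    _ = (∏ i ∈ R, bitGuessProb (S i) (choiceBit R S).other) ^ Real.logb 2 (4 / 3) :=
        Real.finsetProd_rpow _ _ (fun i _ => hpos i _) _
    _ ≤ (deltaMax R S ^ R.card) ^ Real.logb 2 (4 / 3) :=
        Real.rpow_le_rpow (Finset.prod_nonneg fun i _ => hpos i _)
          (prod_bitGuessProb_le_deltaMax R hS) logb_four_thirds_mem.1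
    _ = _ := by
        rw [← Real.rpow_natCast, ← Real.rpow_mul hΔ, ← Real.rpow_natCast, ← Real.rpow_mul hΔ]
        congr 1
        push_cast
        ring

end Uncertainty

/-! ### The joint state -/

section PartialTrace

variable {𝒳 E : Type*} [Fintype 𝒳]

theorem partialTraceLeft_smul (c : ℂ) (ρ : Matrix (𝒳 × E) (𝒳 × E) ℂ) :
    partialTraceLeft (c • ρ) = c • partialTraceLeft ρ := by
  ext a b
  simp [partialTraceLeft, Finset.mul_sum]

theorem partialTraceLeft_sum {ι : Type*} (s : Finset ι) (ρ : ι → Matrix (𝒳 × E) (𝒳 × E) ℂ) :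
    partialTraceLeft (∑ w ∈ s, ρ w) = ∑ w ∈ s, partialTraceLeft (ρ w) := by
  ext a b
  simp only [partialTraceLeft, Matrix.sum_apply, Matrix.of_apply]
  exact Finset.sum_comm

theorem partialTraceLeft_proj_kronecker [DecidableEq 𝒳] (x : 𝒳) (Y : Matrix E E ℂ) :
    partialTraceLeft (proj x ⊗ₖ Y) = Y := by
  ext a b
  simp [partialTraceLeft, proj, Matrix.kroneckerMap_apply, Matrix.single_apply]

theorem uniform_kronecker_partialTraceLeft_sub [DecidableEq 𝒳] {ι : Type*} (c : ℂ) (s : Finset ι) (x : ι → 𝒳)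
    (Y : ι → Matrix E E ℂ) :
    ((Fintype.card 𝒳 : ℂ)⁻¹ • (1 : Matrix 𝒳 𝒳 ℂ)) ⊗ₖ
        partialTraceLeft (c • ∑ w ∈ s, proj (x w) ⊗ₖ Y w) - c • ∑ w ∈ s, proj (x w) ⊗ₖ Y w =
      c • ∑ w ∈ s, ((Fintype.card 𝒳 : ℂ)⁻¹ • (1 : Matrix 𝒳 𝒳 ℂ) - proj (x w)) ⊗ₖ Y w := by
  rw [partialTraceLeft_smul, partialTraceLeft_sum]
  simp only [partialTraceLeft_proj_kronecker]
  ext ⟨a, i⟩ ⟨b, j⟩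
  simp only [Matrix.sub_apply, Matrix.smul_apply, Matrix.sum_apply, Matrix.kroneckerMap_apply,
    smul_eq_mul, sub_mul, Finset.sum_sub_distrib, Finset.mul_sum, mul_sub]
  congr 1
  exact Finset.sum_congr rfl fun w _ => by ring

end PartialTrace

/-! ### Regrouping Alice's choices -/

section Choices

variable {n ℓ : ℕ}

/-- The strings that agree with `Y` outside `I`. -/
def agreeing (I : Finset (Fin n)) (Y : BitString n) : Finset (BitString n) :=
  Fintype.piFinset fun i => if i ∈ I then Finset.univ else {Y i}

theorem mem_agreeing {I : Finset (Fin n)} {X Y : BitString n} :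
    X ∈ agreeing I Y ↔ ∀ i, i ∉ I → X i = Y i := by
  rw [agreeing, Fintype.mem_piFinset]
  refine forall_congr' fun i => ?_
  split_ifs with h <;> simp [h]

theorem prod_ite_mem {M : Type*} [CommMonoid M] (I : Finset (Fin n)) (a : Fin n → M) :
    ∏ i, (if i ∈ I then a i else 1) = ∏ i ∈ I, a i := by
  simp

theorem card_agreeing (I : Finset (Fin n)) (Y : BitString n) :
    (agreeing I Y).card = 2 ^ I.card := by
  rw [agreeing, Fintype.card_piFinset, ← Finset.prod_const, ← prod_ite_mem I fun _ => 2]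
  refine Finset.prod_congr rfl fun i _ => ?_
  split_ifs
  · rw [Finset.card_univ, ZMod.card]
  · simp

/-- Fixing the bits outside `I` through a full string `Y` avoids splitting strings in two; each `X`
is then counted once for every choice of `Y` on `I`. -/
theorem sum_sum_agreeing (I : Finset (Fin n)) (φ : BitString n → ℝ) :
    ∑ Y, ∑ X ∈ agreeing I Y, φ X = 2 ^ I.card * ∑ X, φ X := by
  rw [Finset.sum_comm' (t' := Finset.univ) (s' := fun X => agreeing I X)]
  · simp only [Finset.sum_const, card_agreeing, nsmul_eq_mul, ← Finset.mul_sum]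
    push_cast
    rfl
  · intro Y X
    simp only [mem_agreeing, Finset.mem_univ, true_and, and_true]
    exact ⟨fun h i hi => (h i hi).symm, fun h i hi => (h i hi).symm⟩

/-- The pair of hash functions with `g` for the basis `c` and `f` for the other one. -/
def hashPair (c : Basis) (g f : HashFun n ℓ) : Basis → HashFun n ℓ :=
  fun b => if b = c then g else f

theorem hashPair_self (c : Basis) (g f : HashFun n ℓ) : hashPair c g f c = g := if_pos rfl

theorem hashPair_other (c : Basis) (g f : HashFun n ℓ) : hashPair c g f c.other = f :=
  if_neg c.other_ne

theorem sum_piFinset_basis (c : Basis) (𝓕 : Finset (HashFun n ℓ))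
    (ψ : (Basis → HashFun n ℓ) → ℝ) :
    ∑ F ∈ Fintype.piFinset fun _ : Basis => 𝓕, ψ F =
      ∑ g ∈ 𝓕, ∑ f ∈ 𝓕, ψ (hashPair c g f) := by
  rw [← Finset.sum_product']
  refine Finset.sum_bij' (fun F _ => (F c, F c.other)) (fun p _ => hashPair c p.1 p.2) ?_ ?_ ?_ ?_ ?_
  · intro F hF
    rw [Fintype.mem_piFinset] at hF
    exact Finset.mem_product.2 ⟨hF _, hF _⟩
  · intro p hp
    rw [Fintype.mem_piFinset]
    intro b
    unfold hashPair
    split_ifs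
    · exact (Finset.mem_product.1 hp).1
    · exact (Finset.mem_product.1 hp).2
  · intro F _
    funext b
    unfold hashPair
    split_ifs with h
    · rw [h]
    · rw [Basis.eq_other_of_ne h]
  · intro p _
    simp only [hashPair_self, hashPair_other]
  · intro F _
    congr 1
    funext b
    unfold hashPair
    split_ifs with h
    · rw [h]
    · rw [Basis.eq_other_of_ne h]

theorem restrict_eq_iff {x y : BitString n} {I : Finset (Fin n)} :
    restrict x I = restrict y I ↔ ∀ i ∈ I, x i = y i := by
  constructor
  · intro h i hi
    have : i ∈ Set.range (I.orderEmbOfFin rfl) := by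
      rw [Finset.range_orderEmbOfFin]
      exact hi
    obtain ⟨j, rfl⟩ := this
    exact congrFun h j
  · intro h
    funext j
    exact h _ (Finset.orderEmbOfFin_mem I rfl j)

theorem pad_injective {j : ℕ} (hj : j ≤ n) : Function.Injective (pad (j := j) n) := by
  intro s t h
  funext i
  have := congrFun h ⟨i, i.2.trans_le hj⟩
  simpa [pad] using this

theorem card_bitString (ℓ : ℕ) : Fintype.card (BitString ℓ) = 2 ^ ℓ := by
  simp [ZMod.card]

theorem IsTwoUniversal.card_collision_le {𝓕 : Finset (HashFun n ℓ)} (h𝓕 : IsTwoUniversal 𝓕)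
    {x y : BitString n} (hxy : x ≠ y) :
    ((𝓕.filter fun f => f x = f y).card : ℝ) ≤
      𝓕.card * (Fintype.card (BitString ℓ) : ℝ)⁻¹ := by
  rcases 𝓕.eq_empty_or_nonempty with rfl | h
  · simp
  · have h0 : (0 : ℝ) < 𝓕.card := by exact_mod_cast h.card_pos
    have := (div_le_iff₀ h0).1 (h𝓕 x y hxy)
    rw [Real.rpow_neg two_pos.le, Real.rpow_natCast] at this
    rw [card_bitString, mul_comm]
    exact_mod_cast this

end Choices

/-! ### Security for fixed bases -/

section FixedBases

variable {n ℓ : ℕ} {r : ℕ → ℕ} {d : Fin n → ℕ} (R : Finset (Fin n))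
  (H : ∀ j, Matrix (Fin (r j)) (Fin j) (ZMod 2))
  (S : ∀ i, Matrix (Fin 2) (Fin 2) ℂ →ₗ[ℂ] Matrix (Fin (d i)) (Fin (d i)) ℂ) (c : Basis)

/-- Once `Θ`, `g` and the bits outside the hidden index set are fixed, all registers for the basis
`c` are constant. -/
theorem classicalView_eq_iff {Θ : Fin n → Basis} {Y : BitString n} (g f f' : HashFun n ℓ)
    {X X' : BitString n} (hX : X ∈ agreeing (indexSet R Θ c.other) Y)
    (hX' : X' ∈ agreeing (indexSet R Θ c.other) Y) :
    classicalView R H c (X, Θ, hashPair c g f) = classicalView R H c (X', Θ, hashPair c g f') ↔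
      f = f' ∧ syndrome (H _) (restrict X (indexSet R Θ c.other)) =
        syndrome (H _) (restrict X' (indexSet R Θ c.other)) := by
  constructor
  · intro h
    simp only [classicalView, Prod.mk.injEq] at h
    obtain ⟨-, -, hF, hM⟩ := h
    refine ⟨?_, ?_⟩
    · have := congrFun hF c.other
      rwa [hashPair_other, hashPair_other] at this
    · have := congrFun hM c.other
      exact eq_of_heq (Sigma.mk.inj this).2
  · rintro ⟨rfl, hs⟩
    have hres : restrict X (indexSet R Θ c) = restrict X' (indexSet R Θ c) := by
      rw [restrict_eq_iff]
      intro i hi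
      have hi' : i ∉ indexSet R Θ c.other := by
        intro h
        exact c.other_ne ((Finset.mem_filter.1 h).2.symm.trans (Finset.mem_filter.1 hi).2)
      rw [mem_agreeing.1 hX i hi', mem_agreeing.1 hX' i hi']
    simp only [classicalView, output, hres, Prod.mk.injEq, true_and]
    funext b
    by_cases hb : b = c
    · rw [hb, hres]
    · rw [Basis.eq_other_of_ne hb, hs]

variable {S}

theorem exists_tensor_factor (hS : ∀ i, IsSuperoperator (S i)) (Θ : Fin n → Basis)
    (I : Finset (Fin n)) (Y : BitString n) :
    ∃ (Q : Matrix (∀ i, Fin (d i)) (∀ i, Fin (d i)) ℂ)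
      (B : BitString n → Matrix (∀ i, Fin (d i)) (∀ i, Fin (d i)) ℂ),
      Q.IsHermitian ∧ (∀ X, (B X).PosSemidef) ∧
      (∀ X ∈ agreeing I Y, Q * B X * Q = tensor fun i => S i (bb84 (X i) (Θ i))) ∧
      (Q * Q * (Q * Q)).trace.re = 2 ^ I.card ∧
      ∑ X ∈ agreeing I Y, (B X * B X).trace.re ≤
        2 ^ I.card * ∏ i ∈ I, bitGuessProb (S i) (Θ i) := by
  have hloc : ∀ i, ∃ (Q : Matrix (Fin (d i)) (Fin (d i)) ℂ)
      (B : ZMod 2 → Matrix (Fin (d i)) (Fin (d i)) ℂ),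
      Q.IsHermitian ∧ (∀ z, (B z).PosSemidef) ∧
      (∀ z ∈ (if i ∈ I then Finset.univ else {Y i} : Finset (ZMod 2)),
        Q * B z * Q = S i (bb84 z (Θ i))) ∧
      (Q * Q * (Q * Q)).trace = (if i ∈ I then 2 else 1) ∧
      ∑ z ∈ (if i ∈ I then Finset.univ else {Y i} : Finset (ZMod 2)), (B z * B z).trace.re ≤
        if i ∈ I then 2 * bitGuessProb (S i) (Θ i) else 1 := by
    intro i
    split_ifs with h
    · obtain ⟨Q, B, hQ, hB, hQB, hQ4, hle⟩ := exists_factor_univ (hS i) (Θ i)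
      exact ⟨Q, B, hQ, hB, fun z _ => hQB z, hQ4, hle⟩
    · obtain ⟨Q, B, hQ, hB, hQB, hQ4, hle⟩ := exists_factor_singleton
        ((hS i).bb84_posSemidef (Y i) (Θ i)) ((hS i).trace_bb84 (Y i) (Θ i))
      refine ⟨Q, fun _ => B, hQ, fun _ => hB, fun z hz => ?_, hQ4, by simpa using hle⟩
      rw [Finset.mem_singleton.1 hz, hQB]
  choose Q B hQ hB hQB hQ4 hle using hloc
  refine ⟨tensor Q, fun X => tensor fun i => B i (X i), tensor_isHermitian hQ,
    fun X => tensor_posSemidef fun i => hB i (X i), fun X hX => ?_, ?_, ?_⟩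
  · rw [tensor_mul, tensor_mul]
    congr 1
    funext i
    exact hQB i (X i) (Fintype.mem_piFinset.1 hX i)
  · rw [tensor_mul, tensor_mul, trace_tensor, Finset.prod_congr rfl fun i _ => hQ4 i,
      prod_ite_mem, Finset.prod_const]
    norm_cast
  · calc _ = ∑ X ∈ agreeing I Y, ∏ i, (B i (X i) * B i (X i)).trace.re :=
          Finset.sum_congr rfl fun X _ => re_trace_tensor_mul_self fun i => hB i (X i)
      _ = ∏ i, ∑ z ∈ (if i ∈ I then Finset.univ else {Y i} : Finset (ZMod 2)),
            (B i z * B i z).trace.re := by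
          rw [Finset.prod_univ_sum]
          rfl
      _ ≤ ∏ i, if i ∈ I then 2 * bitGuessProb (S i) (Θ i) else 1 :=
          Finset.prod_le_prod (fun i _ => Finset.sum_nonneg fun z _ =>
            re_trace_mul_nonneg (hB i z) (hB i z)) fun i _ => hle i
      _ = _ := by rw [prod_ite_mem, Finset.prod_mul_distrib, Finset.prod_const]

/-- The deviation from uniform of the state belonging to the choices `w`, tested by `V`. -/
noncomputable def testedDeviation
    (V : Matrix (BitString ℓ × ClassicalView n ℓ r × (∀ i, Fin (d i)))
      (BitString ℓ × ClassicalView n ℓ r × (∀ i, Fin (d i))) ℂ)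
    (S : ∀ i, Matrix (Fin 2) (Fin 2) ℂ →ₗ[ℂ] Matrix (Fin (d i)) (Fin (d i)) ℂ)
    (w : Choices n ℓ) : ℝ :=
  (V * (((Fintype.card (BitString ℓ) : ℂ)⁻¹ • (1 : Matrix (BitString ℓ) (BitString ℓ) ℂ) -
    proj (output R w c.other)) ⊗ₖ (proj (classicalView R H c w) ⊗ₖ quantumView S w))).trace.re

variable {V : Matrix (BitString ℓ × ClassicalView n ℓ r × (∀ i, Fin (d i)))
  (BitString ℓ × ClassicalView n ℓ r × (∀ i, Fin (d i))) ℂ} {𝓕 : Finset (HashFun n ℓ)}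

theorem sum_agreeing_testedDeviation_le (hV : IsContraction V) (hS : ∀ i, IsSuperoperator (S i))
    (h𝓕 : IsTwoUniversal 𝓕) (Θ : Fin n → Basis) (Y : BitString n) (g : HashFun n ℓ) :
    ∑ f ∈ 𝓕, ∑ X ∈ agreeing (indexSet R Θ c.other) Y,
        testedDeviation R H c V S (X, Θ, hashPair c g f) ≤
      𝓕.card * (2 ^ (indexSet R Θ c.other).card *
        √(2 ^ ℓ * 2 ^ r (indexSet R Θ c.other).card *
          ∏ i ∈ indexSet R Θ c.other, bitGuessProb (S i) c.other)) := by
  classical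
  set I := indexSet R Θ c.other with hI
  obtain ⟨Q, B, hQ, hB, hQB, hQ4, hle⟩ := exists_tensor_factor hS Θ I Y
  have hprod : ∏ i ∈ I, bitGuessProb (S i) (Θ i) = ∏ i ∈ I, bitGuessProb (S i) c.other :=
    Finset.prod_congr rfl fun i hi => by rw [(Finset.mem_filter.1 hi).2]
  have hIn : I.card ≤ n := by simpa using Finset.card_le_univ I
  have key := sum_re_trace_hash_le hV (𝓕 := 𝓕) (𝒳 := agreeing I Y)
    (out := fun f X => output R (X, Θ, hashPair c g f) c.other)
    (u := fun X => syndrome (H I.card) (restrict X I))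
    (view := fun f X => classicalView R H c (X, Θ, hashPair c g f))
    (fun f _ X hX f' _ X' hX' => classicalView_eq_iff R H c g f f' hX hX')
    (fun X hX X' hX' hne => by
      simp only [output, hashPair_other]
      -- Distinct strings in `agreeing I Y` differ inside `I`, and padding is injective, so the hash
      -- inputs differ.
      refine h𝓕.card_collision_le fun h => hne ?_
      have h1 := restrict_eq_iff.1 (pad_injective hIn h)
      funext i
      by_cases hi : i ∈ I
      · exact h1 i hi
      · rw [mem_agreeing.1 hX i hi, mem_agreeing.1 hX' i hi])
    hQ (fun X _ => hB X) hQB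
  refine key.trans (mul_le_mul_of_nonneg_left ?_ (Nat.cast_nonneg _))
  rw [hQ4, card_bitString, card_bitString]
  refine Real.sqrt_le_iff.2 ⟨by positivity, ?_⟩
  have hP : 0 ≤ ∏ i ∈ I, bitGuessProb (S i) c.other := Finset.prod_nonneg fun i _ =>
    le_trans (by norm_num) (half_le_bitGuessProb (hS i) _)
  rw [mul_pow, Real.sq_sqrt (by positivity)]
  rw [hprod] at hle
  push_cast
  calc _ ≤ (2 : ℝ) ^ ℓ * 2 ^ r I.card * 2 ^ I.card *
        (2 ^ I.card * ∏ i ∈ I, bitGuessProb (S i) c.other) := by gcongr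
    _ = _ := by ring

theorem sum_testedDeviation_le (hV : IsContraction V) (hS : ∀ i, IsSuperoperator (S i))
    (h𝓕 : IsTwoUniversal 𝓕) (Θ : Fin n → Basis) :
    ∑ X : BitString n, ∑ F ∈ Fintype.piFinset fun _ : Basis => 𝓕,
        testedDeviation R H c V S (X, Θ, F) ≤
      2 ^ n * (𝓕.card : ℝ) ^ 2 * √(2 ^ ℓ * 2 ^ r (indexSet R Θ c.other).card *
          ∏ i ∈ indexSet R Θ c.other, bitGuessProb (S i) c.other) := by
  set I := indexSet R Θ c.other
  set K := √(2 ^ ℓ * 2 ^ r I.card * ∏ i ∈ I, bitGuessProb (S i) c.other)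
  have h2 : (0 : ℝ) < 2 ^ I.card := by positivity
  refine le_of_mul_le_mul_left ?_ h2
  calc 2 ^ I.card * ∑ X : BitString n, ∑ F ∈ Fintype.piFinset fun _ : Basis => 𝓕,
        testedDeviation R H c V S (X, Θ, F)
      = ∑ Y : BitString n, ∑ g ∈ 𝓕, ∑ f ∈ 𝓕, ∑ X ∈ agreeing I Y,
          testedDeviation R H c V S (X, Θ, hashPair c g f) := by
        rw [← sum_sum_agreeing]
        refine Finset.sum_congr rfl fun Y _ => ?_
        simp only [sum_piFinset_basis c]
        rw [Finset.sum_comm]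
        exact Finset.sum_congr rfl fun g _ => Finset.sum_comm
    _ ≤ ∑ Y : BitString n, ∑ g ∈ 𝓕, 𝓕.card * (2 ^ I.card * K) :=
        Finset.sum_le_sum fun Y _ => Finset.sum_le_sum fun g _ =>
          sum_agreeing_testedDeviation_le R H c hV hS h𝓕 Θ Y g
    _ = _ := by
        simp only [Finset.sum_const, Finset.card_univ, card_bitString, nsmul_eq_mul]
        push_cast
        ring

end FixedBases

/-! ### Security averaged over the bases -/

section Security

variable {n ℓ : ℕ} {r : ℕ → ℕ} {d : Fin n → ℕ} {R : Finset (Fin n)} {τ : ℝ}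
  {𝓕 : Finset (HashFun n ℓ)} {H : ∀ j, Matrix (Fin (r j)) (Fin j) (ZMod 2)}
  {S : ∀ i, Matrix (Fin 2) (Fin 2) ℂ →ₗ[ℂ] Matrix (Fin (d i)) (Fin (d i)) ℂ}

/-- Concavity of the square root, in the form of Cauchy–Schwarz against the constant `1`. -/
theorem sum_sqrt_le_card_mul_sqrt {ι : Type*} {s : Finset ι} {a : ι → ℝ} {b : ℝ}
    (ha : ∀ i, 0 ≤ a i) (h : ∑ i ∈ s, a i ≤ s.card * b) :
    ∑ i ∈ s, √(a i) ≤ s.card * √b := by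
  calc ∑ i ∈ s, √(a i) = ∑ i ∈ s, √1 * √(a i) := by simp
    _ ≤ √(∑ i ∈ s, 1) * √(∑ i ∈ s, a i) :=
        Real.sum_sqrt_mul_sqrt_le s (fun _ => zero_le_one) ha
    _ ≤ √s.card * √(s.card * b) := by
        simp only [Finset.sum_const, nsmul_eq_mul, mul_one]
        gcongr
    _ = _ := by
        rw [Real.sqrt_mul (Nat.cast_nonneg _), ← mul_assoc,
          Real.mul_self_sqrt (Nat.cast_nonneg _)]

theorem sqrt_two_pow_mul_le {k : ℕ} {h P : ℝ} (hk : (k : ℝ) ≤ 2 * h) :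
    √(2 ^ ℓ * 2 ^ k * P) ≤ (2 : ℝ) ^ ((ℓ : ℝ) / 2 + h) * √P := by
  rw [Real.sqrt_mul (by positivity)]
  refine mul_le_mul_of_nonneg_right ?_ (Real.sqrt_nonneg _)
  refine Real.sqrt_le_iff.2 ⟨by positivity, ?_⟩
  rw [← Real.rpow_natCast, ← Real.rpow_natCast, ← Real.rpow_add two_pos, ← Real.rpow_natCast,
    ← Real.rpow_mul two_pos.le]
  refine Real.rpow_le_rpow_of_exponent_le one_le_two ?_
  push_cast
  linarith

-- A single `V` tests the whole averaged state. The tested quantity is linear in the state, so it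
-- splits over Alice's choices and is bounded separately for each `Θ`.
open Classical in
theorem nonUniformity_jointState_le (h𝓕 : 𝓕.Nonempty) (h𝓕u : IsTwoUniversal 𝓕)
    (hτ : ∃ Θ, ¬ Aborts R τ Θ) (hS : ∀ i, IsSuperoperator (S i)) (c : Basis) {h : ℝ}
    (hr : ∀ Θ, ¬ Aborts R τ Θ → (r (indexSet R Θ c.other).card : ℝ) ≤ 2 * h) :
    nonUniformity (jointState R τ 𝓕 H S c) ≤ 1 / 2 * ((2 : ℝ) ^ ((ℓ : ℝ) / 2 + h) *
      √(∏ i ∈ R, (1 + bitGuessProb (S i) c.other) / 2)) := by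
  unfold nonUniformity
  refine mul_le_mul_of_nonneg_left ?_ (by norm_num)
  obtain ⟨V, hV, hnorm⟩ := exists_isContraction_traceNorm_eq
    (((Fintype.card (BitString ℓ) : ℂ)⁻¹ • (1 : Matrix (BitString ℓ) (BitString ℓ) ℂ)) ⊗ₖ
      partialTraceLeft (jointState R τ 𝓕 H S c) - jointState R τ 𝓕 H S c)
  rw [hnorm, jointState, uniform_kronecker_partialTraceLeft_sub]
  set T : Finset (Fin n → Basis) := Finset.univ.filter fun Θ => ¬ Aborts R τ Θ with hT
  have hacc : accepted R τ 𝓕 = Finset.univ ×ˢ T ×ˢ Fintype.piFinset fun _ : Basis => 𝓕 := rfl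
  have hcard : ((accepted R τ 𝓕).card : ℝ) = 2 ^ n * (𝓕.card : ℝ) ^ 2 * T.card := by
    rw [hacc, Finset.card_product, Finset.card_product, Fintype.card_piFinset, Finset.card_univ,
      card_bitString]
    simp only [Finset.prod_const, Finset.card_univ, show Fintype.card Basis = 2 from rfl]
    push_cast
    ring
  have hp : ∀ i b, 0 ≤ bitGuessProb (S i) b := fun i b =>
    le_trans (by norm_num) (half_le_bitGuessProb (hS i) b)
  have hT0 : (0 : ℝ) < T.card := by
    obtain ⟨Θ, hΘ⟩ := hτ
    exact_mod_cast Finset.card_pos.2 ⟨Θ, by simpa [hT] using hΘ⟩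
  have h𝓕0 : (0 : ℝ) < 𝓕.card := by exact_mod_cast h𝓕.card_pos
  have hsum : ∑ w ∈ accepted R τ 𝓕, testedDeviation R H c V S w ≤
      2 ^ n * (𝓕.card : ℝ) ^ 2 * (T.card * ((2 : ℝ) ^ ((ℓ : ℝ) / 2 + h) *
        √(∏ i ∈ R, (1 + bitGuessProb (S i) c.other) / 2))) := by
    calc _ = ∑ Θ ∈ T, ∑ X : BitString n, ∑ F ∈ Fintype.piFinset fun _ : Basis => 𝓕,
          testedDeviation R H c V S (X, Θ, F) := by
          rw [hacc]
          simp only [Finset.sum_product]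
          exact Finset.sum_comm
      _ ≤ ∑ Θ ∈ T, 2 ^ n * (𝓕.card : ℝ) ^ 2 * ((2 : ℝ) ^ ((ℓ : ℝ) / 2 + h) *
          √(∏ i ∈ indexSet R Θ c.other, bitGuessProb (S i) c.other)) :=
          Finset.sum_le_sum fun Θ hΘ => (sum_testedDeviation_le R H c hV hS h𝓕u Θ).trans
            (mul_le_mul_of_nonneg_left (sqrt_two_pow_mul_le (hr Θ (Finset.mem_filter.1 hΘ).2))
              (by positivity))
      _ = 2 ^ n * (𝓕.card : ℝ) ^ 2 * ((2 : ℝ) ^ ((ℓ : ℝ) / 2 + h) *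
          ∑ Θ ∈ T, √(∏ i ∈ indexSet R Θ c.other, bitGuessProb (S i) c.other)) := by
          rw [Finset.mul_sum, Finset.mul_sum]
      _ ≤ 2 ^ n * (𝓕.card : ℝ) ^ 2 * ((2 : ℝ) ^ ((ℓ : ℝ) / 2 + h) *
          (T.card * √(∏ i ∈ R, (1 + bitGuessProb (S i) c.other) / 2))) := by
          gcongr
          exact sum_sqrt_le_card_mul_sqrt (fun Θ => Finset.prod_nonneg fun i _ => hp i _)
            (sum_accepted_bases_le R τ c.other (fun i => hp i _)
              fun i => bitGuessProb_le_one (hS i) _)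
      _ = _ := by ring
  rw [Matrix.mul_smul, trace_smul, Finset.mul_sum, trace_sum, smul_eq_mul,
    ← Complex.ofReal_natCast, ← Complex.ofReal_inv, Complex.re_ofReal_mul, Complex.re_sum]
  rw [inv_mul_le_iff₀ (by rw [hcard]; positivity), hcard]
  refine hsum.trans (le_of_eq ?_)
  ring

end Security

end NoisyStorage
theorem mainTheorem3 (n ℓ m : ℕ)
    (R : Finset (Fin n)) (hR : R.card = m)
    (𝓕 : Finset (NoisyStorage.HashFun n ℓ)) (h𝓕 : 𝓕.Nonempty)
    (h𝓕u : NoisyStorage.IsTwoUniversal 𝓕)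
    (p_error : ℝ) (hp0 : 0 ≤ p_error) (hp : p_error < 1 / 2)
    (τ : ℝ) (hτ : ∃ Θ, ¬ NoisyStorage.Aborts R τ Θ)
    (r : ℕ → ℕ) (H : ∀ j, Matrix (Fin (r j)) (Fin j) (ZMod 2))
    (hr : ∀ Θ, ¬ NoisyStorage.Aborts R τ Θ → ∀ b,
      (r (NoisyStorage.indexSet R Θ b).card : ℝ) ≤ NoisyStorage.binaryEntropy p_error * (m / 2))
    (d : Fin n → ℕ)
    (S : ∀ i, Matrix (Fin 2) (Fin 2) ℂ →ₗ[ℂ] Matrix (Fin (d i)) (Fin (d i)) ℂ)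
    (hS : ∀ i, NoisyStorage.IsSuperoperator (S i)) :
    NoisyStorage.deltaSec R τ 𝓕 H S ≤
      (2 : ℝ) ^ ((ℓ : ℝ) / 2 - 1 + NoisyStorage.binaryEntropy p_error * m / 4) *
        NoisyStorage.deltaMax R S ^ (Real.logb 2 (4 / 3) / 2 * m) := by
  have hdelta := NoisyStorage.nonUniformity_jointState_le (H := H) h𝓕 h𝓕u hτ hS
    (NoisyStorage.choiceBit R S) (h := NoisyStorage.binaryEntropy p_error * m / 4)
    fun Θ hΘ => (hr Θ hΘ _).trans_eq (by ring)
  have hsqrt := NoisyStorage.sqrt_prod_one_add_div_two_le R hS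
  rw [hR] at hsqrt
  calc NoisyStorage.deltaSec R τ 𝓕 H S
      ≤ 1 / 2 * ((2 : ℝ) ^ ((ℓ : ℝ) / 2 + NoisyStorage.binaryEntropy p_error * m / 4) *
        NoisyStorage.deltaMax R S ^ (Real.logb 2 (4 / 3) / 2 * m)) := hdelta.trans (by gcongr)
    _ = _ := by
        -- The `-1` in the exponent is the factor `1/2` in the non-uniformity.
        rw [show (ℓ : ℝ) / 2 - 1 + NoisyStorage.binaryEntropy p_error * m / 4 =
          (ℓ : ℝ) / 2 + NoisyStorage.binaryEntropy p_error * m / 4 - 1 by ring,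
          Real.rpow_sub_one two_ne_zero]
        ring
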